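/- **Setting.** Let $M$ be a smooth surface, let $\mathcal A\subset TM\setminus 0$ be a conic sub-bundle (non-empty, open, invariant under $y\mapsto\lambda y$ for $\lambda>0$, and meeting every tangent plane; $\mathcal A_x=\mathcal A\cap T_xM$), and let $F:\mathcal A\to\mathbb R$ be a conic pseudo-Riemannian metric: $F$ is smooth, $F(x,\lambda y)=\lambda F(x,y)$ for $\lambda>0$, $g_{ij}=\tfrac12\dot\partial_i\dot\partial_jF^2$ is non-degenerate on $\mathcal A$ ($\dot\partial_i=\partial/\partial y^i$), and $F^2=a_{ij}(x)y^iy^j$ on $\mathcal A$ for symmetric bilinear forms $a_x$ on $T_xM$. In local coordinates put $\mathfrak g=\det(g_{ij})$, $\varepsilon=\operatorname{sign}\mathfrak g$, $\ell_i=\dot\partial_iF$, $\ell^i=y^i/F$, $(m_1,m_2)=\sqrt{\varepsilon\mathfrak g}\,(-\ell^2,\ell^1)$, $(m^1,m^2)=\frac{\varepsilon}{\sqrt{\varepsilon\mathfrak g}}(-\ell_2,\ell_1)$, $G^i=\tfrac14g^{ij}(y^k\partial_k\dot\partial_jF^2-\partial_jF^2)$, $G^j_i=\dot\partial_iG^j$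 and $\delta_i=\partial_i-G^j_i\dot\partial_j$. For a function $f$ write $f_{;2}=\varepsilon F(\dot\partial_if)m^i$, $f_{,1}=(\delta_if)\ell^i$, $f_{,2}=\varepsilon(\delta_if)m^i$. The main scalar $\mathcal I$ is defined by $F\cdot\tfrac12\dot\partial_kg_{ij}=\mathcal I\,m_im_jm_k$. Let $\phi:\mathcal A\to\mathbb R$ be smooth with $\phi(x,\lambda y)=\phi(x,y)$ for $\lambda>0$ and $$F^2\big(\dot\partial_i\dot\partial_j\phi+(\dot\partial_i\phi)(\dot\partial_j\phi)\big)m^im^j+\varepsilon\neq0\quad\text{on }\mathcal A ,$$ and let $\overline F=e^{\phi}F$. Put $\sigma=\phi_{;2;2}+\varepsilon\mathcal I\phi_{;2}+2(\phi_{;2})^2$, $\rho=1/(\sigma+\varepsilon-(\phi_{;2})^2)$ and $$2Q=\varepsilon\rho F^2(\phi_{;2}\phi_{,1}+\phi_{,1;2}-2\phi_{,2}),\qquad 2P=-\rho F^2\phi_{;2}(\phi_{;2}\phi_{,1}+\phi_{,1;2}-2\phi_{,2})+F^2\phi_{,1},$$ $$\begin{aligned}M^i_{jk}=\frac1{F^2}\Big[&2(P\ell^i+Qm^i)\ell_j\ell_k+\{(P_{;2}-Q)\ell^i+(\varepsilon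 P+Q_{;2})m^i\}(\ell_jm_k+\ell_km_j)\\&+\{(\varepsilon P+P_{;2;2}-2Q_{;2})\ell^i+(2\varepsilon P_{;2}+\varepsilon Q+Q_{;2;2})m^i\}m_jm_k\Big].\end{aligned}$$ Call $\overline F$ Berwaldian if its Berwald curvature $\dot\partial_k\dot\partial_j\dot\partial_i\overline G^h$ vanishes on $\mathcal A$, where $\overline G^h$ are the geodesic spray coefficients of $\overline F$ (given by the formula above with $\overline F$ in place of $F$). All conditions below are understood in every chart of $M$ and at all points of $\mathcal A$. **Theorem.** Consider the assertions * (a) $-3\varepsilon Q-3Q_{;2;2}+\varepsilon P_{;2}+P_{;2;2;2}=0$ and $3P+3\varepsilon P_{;2;2}+\varepsilon Q_{;2}+Q_{;2;2;2}=0$; * (b) there is a smooth symmetric $(1,2)$-tensor field $T$ on $M$ whose components are $T^i_{jk}(x)=M^i_{jk}(x,y)$ for all $(x,y)\in\mathcal A$; * (b$'$) $\dot\partial_rM^i_{jk}=0$; * (c) $\overline F$ is Berwaldian. 1. (a), (b$'$) and (c) are equivalent, and (b) implies (a). 2. If every fibre $\mathcal A_x$ is connected, then (a), (b) and (c) are equivalent.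 3. A smooth symmetric $(1,2)$-tensor field $T$ on $M$ is given by $T^i_{jk}(x)=M^i_{jk}(x,y)$ on $\mathcal A$ if and only if $F^2\,\delta_i(e^{2\phi})=y^k\,T^j_{ik}\,\dot\partial_j\overline F^2$ on $\mathcal A$. -/

import Mathlib

open scoped Manifold ContDiff

noncomputable section

namespace ConicFinsler

/-- The model of a surface. -/
abbrev Plane : Type := EuclideanSpace ℝ (Fin 2)

/-! ### Finsler geometry in local coordinates

A point of `Plane × Plane` is `(x, y)`, where `x` are coordinates on the base and `y` the induced
coordinates on the tangent plane.  Indices `1, 2` of the classical notation are `0, 1 : Fin 2`.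
In this part `F` is the coordinate expression of a metric. -/

/-- `∂f/∂xⁱ`. -/
def baseD (i : Fin 2) (f : Plane × Plane → ℝ) (p : Plane × Plane) : ℝ :=
  fderiv ℝ f p (EuclideanSpace.single i (1 : ℝ), 0)

/-- `∂f/∂yⁱ`. -/
def dotD (i : Fin 2) (f : Plane × Plane → ℝ) (p : Plane × Plane) : ℝ :=
  fderiv ℝ f p (0, EuclideanSpace.single i (1 : ℝ))

/-- The Finsler metric tensor `g_ij = ½ ∂²F²/∂yⁱ∂yʲ`. -/
def metric (F : Plane × Plane → ℝ) (p : Plane × Plane) : Matrix (Fin 2) (Fin 2) ℝ :=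
  Matrix.of fun i j => (1 / 2) * dotD i (dotD j (fun q => F q ^ 2)) p

/-- `ε = ±1`, the sign of `det (g_ij)`. -/
def eps (F : Plane × Plane → ℝ) (p : Plane × Plane) : ℝ := Real.sign (metric F p).det

/-- `ℓ_i = ∂F/∂yⁱ`. -/
def ellLow (F : Plane × Plane → ℝ) (i : Fin 2) (p : Plane × Plane) : ℝ := dotD i F p

/-- `ℓⁱ = yⁱ / F`. -/
def ellUp (F : Plane × Plane → ℝ) (i : Fin 2) (p : Plane × Plane) : ℝ := p.2 i / F p

/-- `(m_1, m_2) = √(ε 𝔤) (-ℓ², ℓ¹)` with `𝔤 = det (g_ij)`. -/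
def mLow (F : Plane × Plane → ℝ) (i : Fin 2) (p : Plane × Plane) : ℝ :=
  Real.sqrt (eps F p * (metric F p).det) * ![-ellUp F 1 p, ellUp F 0 p] i

/-- `(m¹, m²) = (ε / √(ε 𝔤)) (-ℓ_2, ℓ_1)`. -/
def mUp (F : Plane × Plane → ℝ) (i : Fin 2) (p : Plane × Plane) : ℝ :=
  eps F p / Real.sqrt (eps F p * (metric F p).det) * ![-ellLow F 1 p, ellLow F 0 p] i

/-- The coefficients `Gⁱ = ¼ gⁱʲ (yᵏ ∂²F²/∂xᵏ∂yʲ - ∂F²/∂xʲ)` of the geodesic spray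
`S = yⁱ ∂/∂xⁱ - 2 Gⁱ ∂/∂yⁱ`. -/
def spray (F : Plane × Plane → ℝ) (i : Fin 2) (p : Plane × Plane) : ℝ :=
  (1 / 4) * ∑ j, (metric F p)⁻¹ i j *
    ((∑ k, p.2 k * baseD k (dotD j (fun q => F q ^ 2)) p) - baseD j (fun q => F q ^ 2) p)

/-- The Barthel connection `Gʲ_i = ∂Gʲ/∂yⁱ`. -/
def barthel (F : Plane × Plane → ℝ) (j i : Fin 2) : Plane × Plane → ℝ := dotD i (spray F j)

/-- The Berwald connection `Gʰ_ij = ∂Gʰ_j/∂yⁱ`. -/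
def berwaldConnection (F : Plane × Plane → ℝ) (h i j : Fin 2) : Plane × Plane → ℝ :=
  dotD i (barthel F h j)

/-- The Berwald curvature `Gʰ_ijk = ∂Gʰ_ij/∂yᵏ`. -/
def berwaldCurvature (F : Plane × Plane → ℝ) (h i j k : Fin 2) : Plane × Plane → ℝ :=
  dotD k (berwaldConnection F h i j)

/-- The horizontal derivative `δ_i f = ∂f/∂xⁱ - Gʲ_i ∂f/∂yʲ`. -/
def delta (F : Plane × Plane → ℝ) (i : Fin 2) (f : Plane × Plane → ℝ) (p : Plane × Plane) : ℝ :=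
  baseD i f p - ∑ j, barthel F j i p * dotD j f p

/-- The v-scalar derivative `f_{;2} = ε F (∂f/∂yⁱ) mⁱ`. -/
def v2 (F f : Plane × Plane → ℝ) (p : Plane × Plane) : ℝ :=
  eps F p * F p * ∑ i, dotD i f p * mUp F i p

/-- The h-scalar derivative `f_{,1} = (δ_i f) ℓⁱ`. -/
def h1 (F f : Plane × Plane → ℝ) (p : Plane × Plane) : ℝ :=
  ∑ i, delta F i f p * ellUp F i p

/-- The h-scalar derivative `f_{,2} = ε (δ_i f) mⁱ`. -/
def h2 (F f : Plane × Plane → ℝ) (p : Plane × Plane) : ℝ :=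
  eps F p * ∑ i, delta F i f p * mUp F i p

/-- The Cartan tensor `C_ijk = ½ ∂g_ij/∂yᵏ`. -/
def cartan (F : Plane × Plane → ℝ) (i j k : Fin 2) (p : Plane × Plane) : ℝ :=
  (1 / 2) * dotD k (fun q => metric F q i j) p

/-- The main scalar `ℐ`, determined by `F C_ijk = ℐ m_i m_j m_k`; it is obtained by contracting
with `mⁱ mʲ mᵏ`, since `mⁱ m_i = ε` and `ε³ = ε`. -/
def mainScalar (F : Plane × Plane → ℝ) (p : Plane × Plane) : ℝ :=
  eps F p * F p * ∑ i, ∑ j, ∑ k, cartan F i j k p * mUp F i p * mUp F j p * mUp F k p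

/-- `σ = φ_{;2;2} + ε ℐ φ_{;2} + 2 (φ_{;2})²`. -/
def sigma (F φ : Plane × Plane → ℝ) (p : Plane × Plane) : ℝ :=
  v2 F (v2 F φ) p + eps F p * mainScalar F p * v2 F φ p + 2 * v2 F φ p ^ 2

/-- `ρ = 1 / (σ + ε - (φ_{;2})²)`. -/
def rho (F φ : Plane × Plane → ℝ) (p : Plane × Plane) : ℝ :=
  1 / (sigma F φ p + eps F p - v2 F φ p ^ 2)

/-- `2Q = ε ρ F² (φ_{;2} φ_{,1} + φ_{,1;2} - 2 φ_{,2})`. -/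
def Q (F φ : Plane × Plane → ℝ) (p : Plane × Plane) : ℝ :=
  (1 / 2) * (eps F p * rho F φ p * F p ^ 2 *
    (v2 F φ p * h1 F φ p + v2 F (h1 F φ) p - 2 * h2 F φ p))

/-- `2P = -ρ F² φ_{;2} (φ_{;2} φ_{,1} + φ_{,1;2} - 2 φ_{,2}) + F² φ_{,1}`. -/
def P (F φ : Plane × Plane → ℝ) (p : Plane × Plane) : ℝ :=
  (1 / 2) * (-(rho F φ p * F p ^ 2 * v2 F φ p *
    (v2 F φ p * h1 F φ p + v2 F (h1 F φ) p - 2 * h2 F φ p)) + F p ^ 2 * h1 F φ p)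

/-- The expression `Mⁱ_jk(x, y)` built from `P`, `Q` and the frame:
`F² Mⁱ_jk = 2 (P ℓⁱ + Q mⁱ) ℓ_j ℓ_k
  + {(P_{;2} - Q) ℓⁱ + (ε P + Q_{;2}) mⁱ} (ℓ_j m_k + ℓ_k m_j)
  + {(ε P + P_{;2;2} - 2 Q_{;2}) ℓⁱ + (2 ε P_{;2} + ε Q + Q_{;2;2}) mⁱ} m_j m_k`. -/
def Mexpr (F φ : Plane × Plane → ℝ) (i j k : Fin 2) (p : Plane × Plane) : ℝ :=
  1 / F p ^ 2 *
    (2 * (P F φ p * ellUp F i p + Q F φ p * mUp F i p) * (ellLow F j p * ellLow F k p)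
      + ((v2 F (P F φ) p - Q F φ p) * ellUp F i p
          + (eps F p * P F φ p + v2 F (Q F φ) p) * mUp F i p)
        * (ellLow F j p * mLow F k p + ellLow F k p * mLow F j p)
      + ((eps F p * P F φ p + v2 F (v2 F (P F φ)) p - 2 * v2 F (Q F φ) p) * ellUp F i p
          + (2 * eps F p * v2 F (P F φ) p + eps F p * Q F φ p + v2 F (v2 F (Q F φ)) p)
            * mUp F i p)
        * (mLow F j p * mLow F k p))

/-! ### Conic pseudo-Finsler surfaces -/

section Manifold

variable {M : Type*} [TopologicalSpace M] [ChartedSpace Plane M] [IsManifold 𝓘(ℝ, Plane) ∞ M]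

/-- The tangent vector of `M` with induced coordinates `(x, y)` in the chart `e`. -/
def chartVector (e : OpenPartialHomeomorph M Plane) (q : Plane × Plane) :
    TangentBundle 𝓘(ℝ, Plane) M :=
  ⟨e.symm q.1, mfderiv 𝓘(ℝ, Plane) 𝓘(ℝ, Plane) e.symm q.1 q.2⟩

/-- The part of `A ⊆ TM` over the domain of the chart `e`, in the induced coordinates. -/
def chartDomain (e : OpenPartialHomeomorph M Plane) (A : Set (TangentBundle 𝓘(ℝ, Plane) M)) :
    Set (Plane × Plane) :=
  {q | q.1 ∈ e.target ∧ chartVector e q ∈ A}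

/-- The expression of a function on `TM` in the coordinates induced by the chart `e`. -/
def chartRep (e : OpenPartialHomeomorph M Plane) (f : TangentBundle 𝓘(ℝ, Plane) M → ℝ)
    (q : Plane × Plane) : ℝ :=
  f (chartVector e q)

/-- The fibre `A_x = A ∩ T_xM`. -/
def fibre (A : Set (TangentBundle 𝓘(ℝ, Plane) M)) (x : M) :
    Set (TangentSpace 𝓘(ℝ, Plane) x) :=
  {v | (⟨x, v⟩ : TangentBundle 𝓘(ℝ, Plane) M) ∈ A}

/-- Conic sub-bundles of the slit tangent bundle. -/
structure IsConicSubbundle (A : Set (TangentBundle 𝓘(ℝ, Plane) M)) : Prop where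
  nonempty : A.Nonempty
  isOpen : IsOpen A
  ne_zero : ∀ p ∈ A, p.2 ≠ 0
  smul_mem : ∀ p ∈ A, ∀ t : ℝ, 0 < t → (⟨p.1, t • p.2⟩ : TangentBundle 𝓘(ℝ, Plane) M) ∈ A
  fibre_nonempty : ∀ x : M, (fibre A x).Nonempty

/-- Conic pseudo-Finsler metrics: smooth, positively homogeneous of degree one, and with
non-degenerate metric tensor. -/
structure IsConicPseudoFinsler (A : Set (TangentBundle 𝓘(ℝ, Plane) M))
    (F : TangentBundle 𝓘(ℝ, Plane) M → ℝ) : Prop where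
  conic : IsConicSubbundle A
  smooth : ContMDiffOn (𝓘(ℝ, Plane).tangent) 𝓘(ℝ, ℝ) ∞ F A
  homogeneous : ∀ p ∈ A, ∀ t : ℝ, 0 < t → F ⟨p.1, t • p.2⟩ = t * F p
  nondegenerate : ∀ e ∈ IsManifold.maximalAtlas 𝓘(ℝ, Plane) ∞ M, ∀ q ∈ chartDomain e A,
    (metric (chartRep e F) q).det ≠ 0

/-- Conic pseudo-Riemannian metrics: conic pseudo-Finsler metrics with
`F²(x, y) = a_ij(x) yⁱ yʲ` on `A`.  The form `a` is then automatically smooth in `x` and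
non-degenerate. -/
structure IsConicPseudoRiemannian (A : Set (TangentBundle 𝓘(ℝ, Plane) M))
    (F : TangentBundle 𝓘(ℝ, Plane) M → ℝ) : Prop extends IsConicPseudoFinsler A F where
  quadratic : ∀ x : M, ∃ a : LinearMap.BilinForm ℝ (TangentSpace 𝓘(ℝ, Plane) x),
    a.IsSymm ∧ ∀ v ∈ fibre A x, F ⟨x, v⟩ ^ 2 = a v v

/-- `φ` is the conformal factor of an anisotropic conformal change of `F`: it is smooth and
positively homogeneous of degree zero on `A`, and
`F² (∂²φ/∂yⁱ∂yʲ + (∂φ/∂yⁱ)(∂φ/∂yʲ)) mⁱ mʲ + ε ≠ 0` there. -/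
structure IsAnisotropicConformalFactor (A : Set (TangentBundle 𝓘(ℝ, Plane) M))
    (F φ : TangentBundle 𝓘(ℝ, Plane) M → ℝ) : Prop where
  smooth : ContMDiffOn (𝓘(ℝ, Plane).tangent) 𝓘(ℝ, ℝ) ∞ φ A
  homogeneous : ∀ p ∈ A, ∀ t : ℝ, 0 < t → φ ⟨p.1, t • p.2⟩ = φ p
  ne_zero : ∀ e ∈ IsManifold.maximalAtlas 𝓘(ℝ, Plane) ∞ M, ∀ q ∈ chartDomain e A,
    chartRep e F q ^ 2 *
        (∑ i, ∑ j, (dotD i (dotD j (chartRep e φ)) q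
            + dotD i (chartRep e φ) q * dotD j (chartRep e φ) q)
          * mUp (chartRep e F) i q * mUp (chartRep e F) j q)
      + eps (chartRep e F) q ≠ 0

/-- The metric `F̄ = e^φ F`. -/
def conformalChange (φ F : TangentBundle 𝓘(ℝ, Plane) M → ℝ) :
    TangentBundle 𝓘(ℝ, Plane) M → ℝ :=
  fun p => Real.exp (φ p) * F p

/-- `F` is Berwaldian on `A`: its Berwald curvature vanishes. -/
def IsBerwald (A : Set (TangentBundle 𝓘(ℝ, Plane) M))
    (F : TangentBundle 𝓘(ℝ, Plane) M → ℝ) : Prop :=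
  ∀ e ∈ IsManifold.maximalAtlas 𝓘(ℝ, Plane) ∞ M, ∀ q ∈ chartDomain e A,
    ∀ h i j k : Fin 2, berwaldCurvature (chartRep e F) h i j k q = 0

/-- The two identities
`-3εQ - 3Q_{;2;2} + εP_{;2} + P_{;2;2;2} = 0` and `3P + 3εP_{;2;2} + εQ_{;2} + Q_{;2;2;2} = 0`. -/
def PQIdentities (A : Set (TangentBundle 𝓘(ℝ, Plane) M))
    (F φ : TangentBundle 𝓘(ℝ, Plane) M → ℝ) : Prop :=
  ∀ e ∈ IsManifold.maximalAtlas 𝓘(ℝ, Plane) ∞ M, ∀ q ∈ chartDomain e A,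
    let f := chartRep e F
    let p := P f (chartRep e φ)
    let r := Q f (chartRep e φ)
    (-3 * eps f q * r q - 3 * v2 f (v2 f r) q + eps f q * v2 f p q
      + v2 f (v2 f (v2 f p)) q = 0) ∧
    (3 * p q + 3 * eps f q * v2 f (v2 f p) q + eps f q * v2 f r q
      + v2 f (v2 f (v2 f r)) q = 0)

/-- Fields of `(1,2)`-tensors on `M`, as vector-valued bilinear maps on the tangent spaces. -/
abbrev TensorField12 (M : Type*) [TopologicalSpace M] [ChartedSpace Plane M] : Type _ :=
  ∀ x : M, TangentSpace 𝓘(ℝ, Plane) x →ₗ[ℝ] TangentSpace 𝓘(ℝ, Plane) x →ₗ[ℝ]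
    TangentSpace 𝓘(ℝ, Plane) x

/-- The component `Tⁱ_jk(x)` of a tensor field in the chart `e`. -/
def tensorComponent (e : OpenPartialHomeomorph M Plane) (T : TensorField12 M)
    (i j k : Fin 2) (x : Plane) : ℝ :=
  (show Plane from mfderiv 𝓘(ℝ, Plane) 𝓘(ℝ, Plane) e (e.symm x)
    (T (e.symm x)
      (mfderiv 𝓘(ℝ, Plane) 𝓘(ℝ, Plane) e.symm x (EuclideanSpace.single j (1 : ℝ)))
      (mfderiv 𝓘(ℝ, Plane) 𝓘(ℝ, Plane) e.symm x (EuclideanSpace.single k (1 : ℝ))))) i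

/-- Smooth tensor fields that are symmetric in the two lower indices. -/
structure IsSmoothSymmetric (T : TensorField12 M) : Prop where
  symm : ∀ (x : M) (u v : TangentSpace 𝓘(ℝ, Plane) x), T x u v = T x v u
  smooth : ∀ e ∈ IsManifold.maximalAtlas 𝓘(ℝ, Plane) ∞ M, ∀ i j k : Fin 2,
    ContDiffOn ℝ ∞ (tensorComponent e T i j k) e.target

/-- `T` is given by the explicit expression: `Tⁱ_jk(x) = Mⁱ_jk(x, y)` for all `(x, y) ∈ A`. -/
def IsGivenByM (A : Set (TangentBundle 𝓘(ℝ, Plane) M))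
    (F φ : TangentBundle 𝓘(ℝ, Plane) M → ℝ) (T : TensorField12 M) : Prop :=
  ∀ e ∈ IsManifold.maximalAtlas 𝓘(ℝ, Plane) ∞ M, ∀ q ∈ chartDomain e A, ∀ i j k : Fin 2,
    tensorComponent e T i j k q.1 = Mexpr (chartRep e F) (chartRep e φ) i j k q

/-- `∂Mⁱ_jk/∂yʳ = 0` on `A`. -/
def MFibrewiseLocallyConstant (A : Set (TangentBundle 𝓘(ℝ, Plane) M))
    (F φ : TangentBundle 𝓘(ℝ, Plane) M → ℝ) : Prop :=
  ∀ e ∈ IsManifold.maximalAtlas 𝓘(ℝ, Plane) ∞ M, ∀ q ∈ chartDomain e A, ∀ i j k r : Fin 2,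
    dotD r (Mexpr (chartRep e F) (chartRep e φ) i j k) q = 0

/-- `F² δ_i(e^{2φ}) = yᵏ Tʲ_ik ∂F̄²/∂yʲ` on `A`, where `δ_i` is the horizontal derivative of `F`. -/
def SatisfiesFuster (A : Set (TangentBundle 𝓘(ℝ, Plane) M))
    (F φ : TangentBundle 𝓘(ℝ, Plane) M → ℝ) (T : TensorField12 M) : Prop :=
  ∀ e ∈ IsManifold.maximalAtlas 𝓘(ℝ, Plane) ∞ M, ∀ q ∈ chartDomain e A, ∀ i : Fin 2,
    chartRep e F q ^ 2 * delta (chartRep e F) i (fun z => Real.exp (2 * chartRep e φ z)) q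
      = ∑ k, ∑ j, q.2 k * tensorComponent e T j i k q.1
          * dotD j (fun z => chartRep e (conformalChange φ F) z ^ 2) q

end Manifold

end ConicFinsler

end

noncomputable section

namespace ConicFinsler

/-! ### Calculus of the coordinate derivatives -/

section Calculus

variable {U : Set (Plane × Plane)} {h k : Plane × Plane → ℝ} {p : Plane × Plane}

/-! Everything is governed by the vector `D = Ḡ - G`, the difference of the geodesic sprays of `F̄ =
e^φ F` and `F`. Expanding the linear system for `Ḡ` in the Berwald frame shows that `Dⁱ = P ℓⁱ + Q
mⁱ` (`spray_expMul`): the formulas for `P` and `Q` are Cramer's rule for a 2×2 system whose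
determinant `1/ρ` is the nonvanishing quantity of the hypothesis.

Since `F²` is quadratic on fibres, `g_ij` and `√(ε𝔤)` do not depend on `y`, so `ℐ = 0` and the frame
obeys `ℓⁱ_{;2} = ε mⁱ`, `mⁱ_{;2} = -ℓⁱ`. For a 2-homogeneous `h`, Euler's identity then expresses
the second fibre derivatives in the frame (`sq_mul_dotD_dotD`) and leaves a single third derivative,
`F³ ∂³h = (h_{;2;2;2} + 4ε h_{;2}) m⊗m⊗m` (`cube_mul_dotD_dotD_dotD`). Applied to `D`, the first
gives `Mⁱ_jk = ∂_j∂_k Dⁱ` (`Mexpr_eq`); in the second, the `ℓ` and `m` components vanish exactly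
when the two identities of (a) hold (`identities_iff`). Hence (a) is equivalent to (b'). As `G` is
quadratic in `y`, the Berwald curvature of `F̄` is the third fibre derivative of `D`, which is the
derivative of `M` (`berwaldCurvature_expMul`); this gives (c).

A tensor on `M` does not depend on `y`, so (b) gives (b'). Conversely, on connected fibres (b')
makes `M` a function of `x` alone. It transforms as a tensor because the inhomogeneous second-order
term in the transformation law of a spray cancels in a difference (`sprayVec_tangentLift`,
`hessian_tangentLift`).

For the last equivalence, the nonlinear connection of `F̄` annihilates `F̄²`, so `δ_i F̄² = ∂_i Dʲ
∂_j F̄²`. If `T = M`, then `yᵏ Tʲ_ik = ∂_i Dʲ` by Euler. Conversely, the equation says that the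
connection of `Gʲ + ½ Tʲ_ik yⁱ yᵏ` annihilates `F̄²`; a 2-homogeneous spray with this property is
the geodesic one (`spray_eq_of_delta_sq`), so `D` is half the quadratic form of `T` and its Hessian
is `T`. -/

theorem differentiableAt_of_contDiffOn (hU : IsOpen U) (hh : ContDiffOn ℝ ∞ h U) (hp : p ∈ U) :
    DifferentiableAt ℝ h p :=
  (hh.contDiffAt (hU.mem_nhds hp)).differentiableAt (by simp)

theorem contDiffOn_fderiv_apply (hU : IsOpen U) (hh : ContDiffOn ℝ ∞ h U) (v : Plane × Plane) :
    ContDiffOn ℝ ∞ (fun q => fderiv ℝ h q v) U :=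
  (hh.fderiv_of_isOpen hU (by simp)).clm_apply contDiffOn_const

theorem contDiffOn_dotD (hU : IsOpen U) (hh : ContDiffOn ℝ ∞ h U) (i : Fin 2) :
    ContDiffOn ℝ ∞ (dotD i h) U :=
  contDiffOn_fderiv_apply hU hh _

theorem contDiffOn_baseD (hU : IsOpen U) (hh : ContDiffOn ℝ ∞ h U) (i : Fin 2) :
    ContDiffOn ℝ ∞ (baseD i h) U :=
  contDiffOn_fderiv_apply hU hh _

theorem fderiv_congr_of_isOpen (hU : IsOpen U) (hhk : ∀ q ∈ U, h q = k q) (hp : p ∈ U) :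
    fderiv ℝ h p = fderiv ℝ k p :=
  Filter.EventuallyEq.fderiv_eq (Filter.eventually_of_mem (hU.mem_nhds hp) hhk)

theorem dotD_congr (hU : IsOpen U) (hhk : ∀ q ∈ U, h q = k q) (hp : p ∈ U) (i : Fin 2) :
    dotD i h p = dotD i k p := by
  simp only [dotD, fderiv_congr_of_isOpen hU hhk hp]

theorem baseD_congr (hU : IsOpen U) (hhk : ∀ q ∈ U, h q = k q) (hp : p ∈ U) (i : Fin 2) :
    baseD i h p = baseD i k p := by
  simp only [baseD, fderiv_congr_of_isOpen hU hhk hp]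

theorem dotD_const (i : Fin 2) (c : ℝ) : dotD i (fun _ => c) p = 0 := by
  simp [dotD]

theorem dotD_add (hh : DifferentiableAt ℝ h p) (hk : DifferentiableAt ℝ k p) (i : Fin 2) :
    dotD i (fun q => h q + k q) p = dotD i h p + dotD i k p := by
  simp [dotD, fderiv_fun_add hh hk]

theorem dotD_sub (hh : DifferentiableAt ℝ h p) (hk : DifferentiableAt ℝ k p) (i : Fin 2) :
    dotD i (fun q => h q - k q) p = dotD i h p - dotD i k p := by
  simp [dotD, fderiv_fun_sub hh hk]

theorem dotD_mul (hh : DifferentiableAt ℝ h p) (hk : DifferentiableAt ℝ k p) (i : Fin 2) :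
    dotD i (fun q => h q * k q) p = dotD i h p * k p + h p * dotD i k p := by
  simp [dotD, fderiv_fun_mul hh hk]; ring

theorem baseD_mul (hh : DifferentiableAt ℝ h p) (hk : DifferentiableAt ℝ k p) (i : Fin 2) :
    baseD i (fun q => h q * k q) p = baseD i h p * k p + h p * baseD i k p := by
  simp [baseD, fderiv_fun_mul hh hk]; ring

theorem dotD_const_mul (hk : DifferentiableAt ℝ k p) (i : Fin 2) (c : ℝ) :
    dotD i (fun q => c * k q) p = c * dotD i k p := by
  simp [dotD, fderiv_const_mul hk]

theorem baseD_const_mul (hk : DifferentiableAt ℝ k p) (i : Fin 2) (c : ℝ) :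
    baseD i (fun q => c * k q) p = c * baseD i k p := by
  simp [baseD, fderiv_const_mul hk]

theorem dotD_sq (hh : DifferentiableAt ℝ h p) (i : Fin 2) :
    dotD i (fun q => h q ^ 2) p = 2 * h p * dotD i h p := by
  simp only [pow_two]; rw [dotD_mul hh hh]; ring

theorem dotD_inv (hh : DifferentiableAt ℝ h p) (h0 : h p ≠ 0) (i : Fin 2) :
    dotD i (fun q => (h q)⁻¹) p = -dotD i h p / h p ^ 2 := by
  have := (hasDerivAt_inv h0).comp_hasFDerivAt p hh.hasFDerivAt
  simp only [dotD]
  rw [show (fun q => (h q)⁻¹) = Inv.inv ∘ h from rfl, this.fderiv]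
  simp; ring

theorem dotD_exp (hh : DifferentiableAt ℝ h p) (i : Fin 2) :
    dotD i (fun q => Real.exp (h q)) p = Real.exp (h p) * dotD i h p := by
  simp [dotD, fderiv_exp hh]

theorem baseD_exp (hh : DifferentiableAt ℝ h p) (i : Fin 2) :
    baseD i (fun q => Real.exp (h q)) p = Real.exp (h p) * baseD i h p := by
  simp [baseD, fderiv_exp hh]

theorem fderiv_snd_apply (i : Fin 2) (v : Plane × Plane) :
    fderiv ℝ (fun q : Plane × Plane => q.2 i) p v = v.2 i := by
  have := ((EuclideanSpace.proj i : Plane →L[ℝ] ℝ).comp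
    (ContinuousLinearMap.snd ℝ Plane Plane)).hasFDerivAt (x := p)
  have h2 := this.fderiv
  have h3 : fderiv ℝ (fun q : Plane × Plane => q.2 i) p = _ := h2
  rw [h3]; rfl

theorem contDiff_snd_apply (i : Fin 2) : ContDiff ℝ ∞ (fun q : Plane × Plane => q.2 i) :=
  ((EuclideanSpace.proj i : Plane →L[ℝ] ℝ).comp
    (ContinuousLinearMap.snd ℝ Plane Plane)).contDiff

theorem differentiableAt_snd_apply (i : Fin 2) :
    DifferentiableAt ℝ (fun q : Plane × Plane => q.2 i) p :=
  (contDiff_snd_apply i).differentiable (by simp) p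

theorem dotD_snd (i j : Fin 2) :
    dotD j (fun q => q.2 i) p = if i = j then 1 else 0 := by
  simp [dotD, fderiv_snd_apply]

theorem fderiv_fderiv_apply_comm (hU : IsOpen U) (hh : ContDiffOn ℝ ∞ h U) (hp : p ∈ U)
    (v w : Plane × Plane) :
    fderiv ℝ (fun q => fderiv ℝ h q v) p w = fderiv ℝ (fun q => fderiv ℝ h q w) p v := by
  have hd : DifferentiableAt ℝ (fderiv ℝ h) p :=
    ((hh.fderiv_of_isOpen hU (m := ∞) (by simp)).contDiffAt (hU.mem_nhds hp)).differentiableAt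
      (by simp)
  have hs : IsSymmSndFDerivAt ℝ h p :=
    (hh.contDiffAt (hU.mem_nhds hp)).isSymmSndFDerivAt
      (by simpa using WithTop.coe_le_coe.2 (le_top (a := (2 : ℕ∞))))
  rw [fderiv_clm_apply hd (by fun_prop), fderiv_clm_apply hd (by fun_prop)]
  simpa using hs.eq w v

theorem dotD_comm (hU : IsOpen U) (hh : ContDiffOn ℝ ∞ h U) (hp : p ∈ U) (i j : Fin 2) :
    dotD i (dotD j h) p = dotD j (dotD i h) p :=
  fderiv_fderiv_apply_comm hU hh hp _ _

theorem baseD_dotD_comm (hU : IsOpen U) (hh : ContDiffOn ℝ ∞ h U) (hp : p ∈ U) (i j : Fin 2) :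
    baseD i (dotD j h) p = dotD j (baseD i h) p :=
  fderiv_fderiv_apply_comm hU hh hp _ _

end Calculus

/-! ### Homogeneous functions -/

/-- Smooth functions on `U` that satisfy Euler's identity of degree `r` in the fibre variable. -/
structure IsHomog (U : Set (Plane × Plane)) (r : ℝ) (h : Plane × Plane → ℝ) : Prop where
  smooth : ContDiffOn ℝ ∞ h U
  euler : ∀ p ∈ U, p.2 0 * dotD 0 h p + p.2 1 * dotD 1 h p = r * h p

namespace IsHomog

variable {U : Set (Plane × Plane)} {h k : Plane × Plane → ℝ} {p : Plane × Plane} {r s t : ℝ}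

theorem differentiableAt (hh : IsHomog U r h) (hU : IsOpen U) (hp : p ∈ U) :
    DifferentiableAt ℝ h p :=
  differentiableAt_of_contDiffOn hU hh.smooth hp

theorem congr (hh : IsHomog U r h) (hU : IsOpen U) (e : ∀ q ∈ U, k q = h q) :
    IsHomog U r k where
  smooth := hh.smooth.congr e
  euler p hp := by
    rw [dotD_congr hU e hp, dotD_congr hU e hp, e p hp, hh.euler p hp]

theorem const (c : ℝ) : IsHomog U 0 (fun _ => c) where
  smooth := contDiffOn_const
  euler p _ := by simp [dotD_const]

theorem of_dotD_eq_zero (hs : ContDiffOn ℝ ∞ h U) (h0 : ∀ p ∈ U, ∀ i, dotD i h p = 0) :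
    IsHomog U 0 h where
  smooth := hs
  euler p hp := by simp [h0 p hp]

theorem snd (i : Fin 2) : IsHomog U 1 (fun q => q.2 i) where
  smooth := (contDiff_snd_apply i).contDiffOn
  euler p _ := by fin_cases i <;> simp [dotD_snd]

theorem add (hh : IsHomog U r h) (hk : IsHomog U r k) (hU : IsOpen U) :
    IsHomog U r (fun q => h q + k q) where
  smooth := hh.smooth.add hk.smooth
  euler p hp := by
    rw [dotD_add (hh.differentiableAt hU hp) (hk.differentiableAt hU hp),
      dotD_add (hh.differentiableAt hU hp) (hk.differentiableAt hU hp)]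
    linear_combination hh.euler p hp + hk.euler p hp

theorem sub (hh : IsHomog U r h) (hk : IsHomog U r k) (hU : IsOpen U) :
    IsHomog U r (fun q => h q - k q) where
  smooth := hh.smooth.sub hk.smooth
  euler p hp := by
    rw [dotD_sub (hh.differentiableAt hU hp) (hk.differentiableAt hU hp),
      dotD_sub (hh.differentiableAt hU hp) (hk.differentiableAt hU hp)]
    linear_combination hh.euler p hp - hk.euler p hp

theorem mul (hh : IsHomog U r h) (hk : IsHomog U s k) (hU : IsOpen U) (ht : r + s = t) :
    IsHomog U t (fun q => h q * k q) where
  smooth := hh.smooth.mul hk.smooth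
  euler p hp := by
    rw [dotD_mul (hh.differentiableAt hU hp) (hk.differentiableAt hU hp),
      dotD_mul (hh.differentiableAt hU hp) (hk.differentiableAt hU hp), ← ht]
    linear_combination k p * hh.euler p hp + h p * hk.euler p hp

theorem const_mul (hh : IsHomog U r h) (hU : IsOpen U) (c : ℝ) :
    IsHomog U r (fun q => c * h q) :=
  (const c).mul hh hU (zero_add r)

theorem sq (hh : IsHomog U r h) (hU : IsOpen U) (ht : r + r = t) :
    IsHomog U t (fun q => h q ^ 2) :=
  (hh.mul hh hU ht).congr hU fun _ _ => pow_two _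

theorem inv (hh : IsHomog U r h) (hU : IsOpen U) (h0 : ∀ q ∈ U, h q ≠ 0) (ht : -r = t) :
    IsHomog U t (fun q => (h q)⁻¹) where
  smooth := hh.smooth.inv h0
  euler p hp := by
    have := h0 p hp
    rw [dotD_inv (hh.differentiableAt hU hp) this, dotD_inv (hh.differentiableAt hU hp) this, ← ht]
    field_simp
    linear_combination -hh.euler p hp

theorem div (hh : IsHomog U r h) (hk : IsHomog U s k) (hU : IsOpen U) (h0 : ∀ q ∈ U, k q ≠ 0)
    (ht : r - s = t) : IsHomog U t (fun q => h q / k q) :=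
  (hh.mul (hk.inv hU h0 rfl) hU (by linarith)).congr hU fun _ _ => div_eq_mul_inv _ _

theorem dotD (hh : IsHomog U r h) (hU : IsOpen U) (j : Fin 2) (ht : r - 1 = t) :
    IsHomog U t (dotD j h) where
  smooth := contDiffOn_dotD hU hh.smooth j
  euler p hp := by
    have d := fun i => differentiableAt_of_contDiffOn hU (contDiffOn_dotD hU hh.smooth i) hp
    have d2 := fun i => differentiableAt_snd_apply (p := p) i
    -- Differentiating Euler's identity in `yʲ` produces the extra summand `∂_j h` from the explicit
    -- `yʲ`, which lowers the degree by one.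
    have e := dotD_congr hU hh.euler hp j
    rw [dotD_add ((d2 0).fun_mul (d 0)) ((d2 1).fun_mul (d 1)), dotD_mul (d2 0) (d 0),
      dotD_mul (d2 1) (d 1), dotD_const_mul (hh.differentiableAt hU hp), dotD_snd, dotD_snd,
      dotD_comm hU hh.smooth hp j 0, dotD_comm hU hh.smooth hp j 1] at e
    rw [← ht]
    fin_cases j <;> simp at e ⊢ <;> linear_combination e

theorem baseD (hh : IsHomog U r h) (hU : IsOpen U) (j : Fin 2) : IsHomog U r (baseD j h) where
  smooth := contDiffOn_baseD hU hh.smooth j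
  euler p hp := by
    have d := fun i => differentiableAt_of_contDiffOn hU (contDiffOn_dotD hU hh.smooth i) hp
    have d2 := fun i => differentiableAt_snd_apply (p := p) i
    have e := baseD_congr hU hh.euler hp j
    have hz : ∀ i, ConicFinsler.baseD j (fun q => q.2 i) p = 0 := fun i => by
      simp [ConicFinsler.baseD, fderiv_snd_apply]
    have ha : ∀ {a b : Plane × Plane → ℝ}, DifferentiableAt ℝ a p → DifferentiableAt ℝ b p →
        ConicFinsler.baseD j (fun q => a q + b q) p
          = ConicFinsler.baseD j a p + ConicFinsler.baseD j b p := fun h1 h2 => by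
      simp [ConicFinsler.baseD, fderiv_fun_add h1 h2]
    rw [ha ((d2 0).fun_mul (d 0)) ((d2 1).fun_mul (d 1)), baseD_mul (d2 0) (d 0),
      baseD_mul (d2 1) (d 1), baseD_const_mul (hh.differentiableAt hU hp), hz, hz,
      baseD_dotD_comm hU hh.smooth hp j 0, baseD_dotD_comm hU hh.smooth hp j 1] at e
    linear_combination e

theorem exp (hh : IsHomog U 0 h) (hU : IsOpen U) : IsHomog U 0 (fun q => Real.exp (h q)) where
  smooth := hh.smooth.exp
  euler p hp := by
    rw [dotD_exp (hh.differentiableAt hU hp), dotD_exp (hh.differentiableAt hU hp)]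
    linear_combination Real.exp (h p) * hh.euler p hp

end IsHomog

/-! ### The geodesic spray of a metric in coordinates -/

/-- Conic pseudo-Finsler metrics on an open set of coordinates `(x, y)`. -/
structure IsLocalMetric (U : Set (Plane × Plane)) (F : Plane × Plane → ℝ) : Prop where
  isOpen : IsOpen U
  snd_ne_zero : ∀ p ∈ U, p.2 ≠ 0
  homog : IsHomog U 1 F
  det_ne_zero : ∀ p ∈ U, (metric F p).det ≠ 0

/-- The right-hand side `yᵏ ∂²F²/∂xᵏ∂yⁱ - ∂F²/∂xⁱ` of the linear system `4 g_ij Gʲ = …`. -/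
def eulerLagrange (F : Plane × Plane → ℝ) (i : Fin 2) (p : Plane × Plane) : ℝ :=
  (∑ k, p.2 k * baseD k (dotD i (fun q => F q ^ 2)) p) - baseD i (fun q => F q ^ 2) p

namespace IsLocalMetric

variable {U : Set (Plane × Plane)} {F : Plane × Plane → ℝ} {p : Plane × Plane}

theorem homog_sq (hF : IsLocalMetric U F) : IsHomog U 2 (fun q => F q ^ 2) :=
  hF.homog.sq hF.isOpen (by norm_num)

theorem homog_metric (hF : IsLocalMetric U F) (i j : Fin 2) :
    IsHomog U 0 (fun q => metric F q i j) :=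
  ((hF.homog_sq.dotD hF.isOpen j rfl).dotD hF.isOpen i (by norm_num)).const_mul hF.isOpen (1 / 2)

theorem homog_det (hF : IsLocalMetric U F) : IsHomog U 0 (fun q => (metric F q).det) :=
  (((hF.homog_metric 0 0).mul (hF.homog_metric 1 1) hF.isOpen (by norm_num)).sub
    ((hF.homog_metric 0 1).mul (hF.homog_metric 1 0) hF.isOpen (by norm_num)) hF.isOpen).congr
      hF.isOpen fun _ _ => Matrix.det_fin_two _

theorem metric_comm (hF : IsLocalMetric U F) (hp : p ∈ U) (i j : Fin 2) :
    metric F p i j = metric F p j i := by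
  simp only [metric, Matrix.of_apply]
  rw [dotD_comm hF.isOpen hF.homog_sq.smooth hp]

theorem homog_eulerLagrange (hF : IsLocalMetric U F) (i : Fin 2) :
    IsHomog U 2 (eulerLagrange F i) := by
  have h := fun k => (IsHomog.snd k).mul
    ((hF.homog_sq.dotD hF.isOpen i (t := 1) (by norm_num)).baseD hF.isOpen k) hF.isOpen
    (t := 2) (by norm_num)
  exact (((h 0).add (h 1) hF.isOpen).sub (hF.homog_sq.baseD hF.isOpen i) hF.isOpen).congr hF.isOpen
    fun q _ => by simp [eulerLagrange]

theorem sum_metric_snd (hF : IsLocalMetric U F) (hp : p ∈ U) (i : Fin 2) :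
    metric F p i 0 * p.2 0 + metric F p i 1 * p.2 1 = F p * dotD i F p := by
  have e := (hF.homog_sq.dotD hF.isOpen i (t := 1) (by norm_num)).euler p hp
  rw [dotD_sq (hF.homog.differentiableAt hF.isOpen hp)] at e
  rw [hF.metric_comm hp i 0, hF.metric_comm hp i 1]
  simp only [metric, Matrix.of_apply]
  linear_combination (1 / 2) * e

/-- If `F` vanished at `(x, y)`, then `g_ij yʲ = F ∂_i F` would vanish too, and non-degeneracy would
force `y = 0`. So the domain contains no null vectors, and division by `F` is harmless. -/
theorem ne_zero (hF : IsLocalMetric U F) (hp : p ∈ U) : F p ≠ 0 := by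
  intro h0
  refine hF.snd_ne_zero p hp ?_
  have e := hF.sum_metric_snd hp
  have hd := hF.det_ne_zero p hp
  rw [Matrix.det_fin_two] at hd
  simp only [h0, zero_mul] at e
  have h1 : p.2 0 = 0 := (mul_eq_zero.1 (show _ * p.2 0 = 0 by
    linear_combination metric F p 1 1 * e 0 - metric F p 0 1 * e 1)).resolve_left hd
  have h2 : p.2 1 = 0 := (mul_eq_zero.1 (show _ * p.2 1 = 0 by
    linear_combination metric F p 0 0 * e 1 - metric F p 1 0 * e 0)).resolve_left hd
  ext i
  fin_cases i
  · exact h1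
  · exact h2

theorem sum_metric_spray (hF : IsLocalMetric U F) (hp : p ∈ U) (i : Fin 2) :
    metric F p i 0 * spray F 0 p + metric F p i 1 * spray F 1 p
      = (1 / 4) * eulerLagrange F i p := by
  have hd := Matrix.mul_nonsing_inv _ (isUnit_iff_ne_zero.2 (hF.det_ne_zero p hp))
  have h : ∀ j, spray F j p = (1 / 4) *
      ((metric F p)⁻¹ j 0 * eulerLagrange F 0 p + (metric F p)⁻¹ j 1 * eulerLagrange F 1 p) := by
    intro j; simp [spray, eulerLagrange]
  rw [h, h]
  have e := fun j => congrFun (congrFun hd i) j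
  simp only [Matrix.mul_apply, Fin.sum_univ_two] at e
  have e0 := e 0
  have e1 := e 1
  fin_cases i <;> simp [Matrix.one_apply] at e0 e1 ⊢ <;>
    linear_combination (1 / 4) * eulerLagrange F 0 p * e0 + (1 / 4) * eulerLagrange F 1 p * e1

theorem spray_eq_of_sum_metric (hF : IsLocalMetric U F) (hp : p ∈ U) {w : Fin 2 → ℝ}
    (hw : ∀ i, metric F p i 0 * w 0 + metric F p i 1 * w 1 = (1 / 4) * eulerLagrange F i p)
    (i : Fin 2) : spray F i p = w i := by
  have hd := hF.det_ne_zero p hp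
  rw [Matrix.det_fin_two] at hd
  have e := fun i => (hF.sum_metric_spray hp i).trans (hw i).symm
  fin_cases i
  · exact mul_left_cancel₀ hd (by
      simp only [Fin.zero_eta]
      linear_combination metric F p 1 1 * e 0 - metric F p 0 1 * e 1)
  · exact mul_left_cancel₀ hd (by
      simp only [Fin.mk_one]
      linear_combination metric F p 0 0 * e 1 - metric F p 1 0 * e 0)

theorem homog_spray (hF : IsLocalMetric U F) (i : Fin 2) : IsHomog U 2 (spray F i) := by
  have hg := fun i j k => (hF.homog_metric i j).mul (hF.homog_eulerLagrange k) hF.isOpen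
    (t := 2) (by norm_num)
  -- Cramer's rule replaces the matrix inverse by quotients of functions already known to be smooth
  -- and homogeneous.
  have hw : ∀ p ∈ U, ∀ i, spray F i p =
      ![(1 / 4) * ((metric F p 1 1 * eulerLagrange F 0 p - metric F p 0 1 * eulerLagrange F 1 p)
          / (metric F p).det),
        (1 / 4) * ((metric F p 0 0 * eulerLagrange F 1 p - metric F p 1 0 * eulerLagrange F 0 p)
          / (metric F p).det)] i := by
    intro p hp
    refine hF.spray_eq_of_sum_metric hp fun i => ?_
    have hd := mul_inv_cancel₀ (hF.det_ne_zero p hp)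
    nth_rewrite 1 [Matrix.det_fin_two] at hd
    fin_cases i <;> simp [div_eq_mul_inv]
    · linear_combination (1 / 4) * eulerLagrange F 0 p * hd
    · linear_combination (1 / 4) * eulerLagrange F 1 p * hd
  have hq := fun {h : Plane × Plane → ℝ} (hh : IsHomog U 2 h) =>
    (hh.div hF.homog_det hF.isOpen hF.det_ne_zero (t := 2) (by norm_num)).const_mul
      hF.isOpen (1 / 4)
  fin_cases i
  · exact (hq ((hg 1 1 0).sub (hg 0 1 1) hF.isOpen)).congr hF.isOpen fun q hq => hw q hq 0
  · exact (hq ((hg 0 0 1).sub (hg 1 0 0) hF.isOpen)).congr hF.isOpen fun q hq => hw q hq 1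

/-- `yᵏ ∂F²/∂xᵏ = 2 Gʲ ∂F²/∂yʲ`. -/
theorem sum_snd_baseD_sq (hF : IsLocalMetric U F) (hp : p ∈ U) :
    p.2 0 * baseD 0 (fun q => F q ^ 2) p + p.2 1 * baseD 1 (fun q => F q ^ 2) p
      = 2 * (spray F 0 p * dotD 0 (fun q => F q ^ 2) p
        + spray F 1 p * dotD 1 (fun q => F q ^ 2) p) := by
  have e := hF.sum_metric_spray hp
  have g := fun i => hF.sum_metric_snd hp i
  have c := hF.metric_comm hp 0 1
  have b := fun i => (hF.homog_sq.baseD hF.isOpen i).euler p hp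
  have d := fun i k => baseD_dotD_comm hF.isOpen hF.homog_sq.smooth hp k i
  simp only [eulerLagrange, Fin.sum_univ_two, d] at e
  rw [dotD_sq (hF.homog.differentiableAt hF.isOpen hp),
    dotD_sq (hF.homog.differentiableAt hF.isOpen hp)]
  -- Contraction of `4 g_ij Gʲ = yᵏ ∂_k ∂F²/∂yⁱ - ∂_i F²` with `yⁱ`: the left side is `2 Gʲ
  -- ∂F²/∂yʲ`, and on the right Euler's identity for `∂_k F²` leaves `2 - 1 = 1` copy of `yᵏ ∂_k
  -- F²`.
  linear_combination -4 * p.2 0 * e 0 - 4 * p.2 1 * e 1 - p.2 0 * b 0 - p.2 1 * b 1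
    + 4 * spray F 0 p * g 0 + 4 * spray F 1 p * g 1
    + 4 * (spray F 1 p * p.2 0 - spray F 0 p * p.2 1) * c

/-- The horizontal derivatives of a metric vanish. -/
theorem delta_sq (hF : IsLocalMetric U F) (hp : p ∈ U) (i : Fin 2) :
    baseD i (fun q => F q ^ 2) p = dotD i (spray F 0) p * dotD 0 (fun q => F q ^ 2) p
      + dotD i (spray F 1) p * dotD 1 (fun q => F q ^ 2) p := by
  have hU := hF.isOpen
  have e := hF.sum_metric_spray hp i
  -- Differentiating the contracted identity in `yⁱ` and eliminating the second fibre derivatives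
  -- with `4 g_ij Gʲ = …` leaves twice the claim.
  have s := dotD_congr hU (fun q hq => hF.sum_snd_baseD_sq hq) hp i
  have db := fun k => (hF.homog_sq.baseD hU k).differentiableAt hU hp
  have dd := fun k => (hF.homog_sq.dotD hU k rfl).differentiableAt hU hp
  have dG := fun k => (hF.homog_spray k).differentiableAt hU hp
  have dy := fun k => differentiableAt_snd_apply (p := p) k
  rw [dotD_add ((dy 0).fun_mul (db 0)) ((dy 1).fun_mul (db 1)), dotD_mul (dy 0) (db 0),
    dotD_mul (dy 1) (db 1),
    dotD_const_mul (((dG 0).fun_mul (dd 0)).fun_add ((dG 1).fun_mul (dd 1))),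
    dotD_add ((dG 0).fun_mul (dd 0)) ((dG 1).fun_mul (dd 1)),
    dotD_mul (dG 0) (dd 0), dotD_mul (dG 1) (dd 1), dotD_snd, dotD_snd] at s
  simp only [eulerLagrange, Fin.sum_univ_two, metric, Matrix.of_apply,
    baseD_dotD_comm hF.isOpen hF.homog_sq.smooth hp _ i] at e
  fin_cases i <;> simp at e s ⊢ <;> linear_combination 2 * e + (1 / 2) * s

/-- A quadratic spray whose nonlinear connection annihilates `F²` is the geodesic spray of `F`. -/
theorem spray_eq_of_delta_sq (hF : IsLocalMetric U F) {G : Fin 2 → Plane × Plane → ℝ}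
    (hG : ∀ i, IsHomog U 2 (G i))
    (h : ∀ p ∈ U, ∀ i, baseD i (fun q => F q ^ 2) p = dotD i (G 0) p * dotD 0 (fun q => F q ^ 2) p
      + dotD i (G 1) p * dotD 1 (fun q => F q ^ 2) p) (hp : p ∈ U) (i : Fin 2) :
    spray F i p = G i p := by
  have hU := hF.isOpen
  have db := fun k => (hF.homog_sq.baseD hU k).differentiableAt hU hp
  have dd := fun k => (hF.homog_sq.dotD hU k rfl).differentiableAt hU hp
  have dG := fun k => (hG k).differentiableAt hU hp
  have dy := fun k => differentiableAt_snd_apply (p := p) k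
  refine hF.spray_eq_of_sum_metric hp (w := fun i => G i p) (fun i => ?_) i
  -- Contracting the hypothesis with `yⁱ` and using `yⁱ ∂Gʲ/∂yⁱ = 2 Gʲ` recovers the contracted
  -- identity for `G`. Its fibre derivative, combined with the hypothesis, is the linear system that
  -- determines the spray.
  have s : ∀ q ∈ U, q.2 0 * baseD 0 (fun q => F q ^ 2) q + q.2 1 * baseD 1 (fun q => F q ^ 2) q
      = 2 * (G 0 q * dotD 0 (fun q => F q ^ 2) q + G 1 q * dotD 1 (fun q => F q ^ 2) q) := by
    intro q hq
    rw [h q hq, h q hq]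
    linear_combination dotD 0 (fun q => F q ^ 2) q * (hG 0).euler q hq
      + dotD 1 (fun q => F q ^ 2) q * (hG 1).euler q hq
  have s := dotD_congr hU s hp i
  rw [dotD_add ((dy 0).fun_mul (db 0)) ((dy 1).fun_mul (db 1)), dotD_mul (dy 0) (db 0),
    dotD_mul (dy 1) (db 1),
    dotD_const_mul (((dG 0).fun_mul (dd 0)).fun_add ((dG 1).fun_mul (dd 1))),
    dotD_add ((dG 0).fun_mul (dd 0)) ((dG 1).fun_mul (dd 1)),
    dotD_mul (dG 0) (dd 0), dotD_mul (dG 1) (dd 1), dotD_snd, dotD_snd] at s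
  have hi := h p hp i
  simp only [eulerLagrange, Fin.sum_univ_two, metric, Matrix.of_apply,
    baseD_dotD_comm hF.isOpen hF.homog_sq.smooth hp _ i]
  fin_cases i <;> simp at s hi ⊢ <;> linear_combination (1 / 2) * hi - (1 / 4) * s

end IsLocalMetric

/-! ### Functions prescribed on a single fibre -/

section Fibre

variable {U : Set (Plane × Plane)} {h k : Plane × Plane → ℝ} {p : Plane × Plane}

theorem dotD_eq_zero_of_forall_fst_eq (hU : IsOpen U) (hh : DifferentiableAt ℝ h p) (hp : p ∈ U)
    (hc : ∀ q ∈ U, q.1 = p.1 → h q = h p) (i : Fin 2) : dotD i h p = 0 := by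
  have h1 : HasDerivAt
      (fun t : ℝ => h (p + t • ((0, EuclideanSpace.single i (1 : ℝ)) : Plane × Plane)))
      (dotD i h p) 0 := hh.hasFDerivAt.hasLineDerivAt _
  have hcont : ContinuousAt
      (fun t : ℝ => p + t • ((0, EuclideanSpace.single i (1 : ℝ)) : Plane × Plane)) 0 := by
    fun_prop
  have hev : (fun t : ℝ => h (p + t • ((0, EuclideanSpace.single i (1 : ℝ)) : Plane × Plane)))
      =ᶠ[nhds 0] fun _ => h p := by
    filter_upwards [hcont.preimage_mem_nhds (by simpa using hU.mem_nhds hp)] with t ht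
    exact hc _ ht (by simp)
  exact (h1.congr_of_eventuallyEq hev.symm).unique (hasDerivAt_const _ _)

theorem dotD_eq_of_forall_fst_eq {x : Plane} (hU : IsOpen U) (hh : ContDiffOn ℝ ∞ h U)
    (hk : ContDiffOn ℝ ∞ k U) (hc : ∀ q ∈ U, q.1 = x → h q = k q) (i : Fin 2) :
    ∀ q ∈ U, q.1 = x → dotD i h q = dotD i k q := by
  intro q hq hx
  have dh := differentiableAt_of_contDiffOn hU hh hq
  have dk := differentiableAt_of_contDiffOn hU hk hq
  have := dotD_eq_zero_of_forall_fst_eq hU (dh.fun_sub dk) hq (fun r hr hr' => by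
    rw [hc r hr (hr'.trans hx), hc q hq hx, sub_self, sub_self]) i
  rw [dotD_sub dh dk] at this
  exact sub_eq_zero.1 this

/-- A metric whose square is quadratic on the fibres has a fibrewise constant metric tensor. -/
theorem dotD_metric_eq_zero (hU : IsOpen U) (hh : ContDiffOn ℝ ∞ h U)
    (hq : ∀ x : Plane, ∃ a b c : ℝ, ∀ q ∈ U, q.1 = x →
      h q ^ 2 = a * q.2 0 ^ 2 + b * (q.2 0 * q.2 1) + c * q.2 1 ^ 2) (hp : p ∈ U) (i j k : Fin 2) :
    dotD k (fun q => metric h q i j) p = 0 := by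
  obtain ⟨a, b, c, habc⟩ := hq p.1
  have dy := fun (p : Plane × Plane) k => differentiableAt_snd_apply (p := p) k
  -- The coefficients are frozen at the base point of `p`. Agreement on that one fibre passes to all
  -- fibre derivatives, so no regularity of the quadratic form in `x` is needed.
  let E : Plane × Plane → ℝ := fun q => a * q.2 0 ^ 2 + b * (q.2 0 * q.2 1) + c * q.2 1 ^ 2
  have cy := contDiff_snd_apply
  have hE : ContDiffOn ℝ ∞ E U :=
    (((contDiff_const.mul ((cy 0).pow 2)).add (contDiff_const.mul ((cy 0).mul (cy 1)))).add
      (contDiff_const.mul ((cy 1).pow 2))).contDiffOn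
  have hE1 : ∀ j, dotD j E = fun q =>
      ![2 * a, b] j * q.2 0 + ![b, 2 * c] j * q.2 1 := by
    intro j
    funext q
    have d2 := fun k => (dy q k).fun_pow 2
    have d3 := (dy q 0).fun_mul (dy q 1)
    simp only [E]
    rw [dotD_add (((d2 0).const_mul a).fun_add (d3.const_mul b)) ((d2 1).const_mul c),
      dotD_add ((d2 0).const_mul a) (d3.const_mul b), dotD_const_mul (d2 0), dotD_const_mul d3,
      dotD_const_mul (d2 1), dotD_sq (dy q 0), dotD_sq (dy q 1), dotD_mul (dy q 0) (dy q 1),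
      dotD_snd, dotD_snd]
    fin_cases j <;> simp <;> ring
  have hE2 : ∀ i j, dotD i (dotD j E) = fun _ =>
      ![2 * a, b] j * (if 0 = i then 1 else 0) + ![b, 2 * c] j * (if 1 = i then 1 else 0) := by
    intro i j
    funext q
    rw [hE1 j, dotD_add ((dy q 0).const_mul _) ((dy q 1).const_mul _), dotD_const_mul (dy q 0),
      dotD_const_mul (dy q 1), dotD_snd, dotD_snd]
  have s0 : ContDiffOn ℝ ∞ (fun q => h q ^ 2) U := hh.pow 2
  have s1 := contDiffOn_dotD hU s0 j
  have t1 := contDiffOn_dotD hU hE j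
  have s2 := contDiffOn_dotD hU s1 i
  have e3 := dotD_eq_of_forall_fst_eq hU s2 (contDiffOn_dotD hU t1 i)
    (dotD_eq_of_forall_fst_eq hU s1 t1 (dotD_eq_of_forall_fst_eq hU s0 hE habc j) i) k p hp rfl
  simp only [metric, Matrix.of_apply]
  rw [dotD_const_mul (differentiableAt_of_contDiffOn hU s2 hp), e3, hE2, dotD_const, mul_zero]

end Fibre

/-! ### The Berwald frame of a pseudo-Riemannian metric -/

/-- Conic pseudo-Riemannian metrics on an open set of coordinates. -/
structure IsLocalRiemannian (U : Set (Plane × Plane)) (F : Plane × Plane → ℝ) : Prop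
    extends IsLocalMetric U F where
  dotD_metric : ∀ p ∈ U, ∀ i j k, dotD k (fun q => metric F q i j) p = 0

/-- The density `√(ε 𝔤)`. -/
def density (F : Plane × Plane → ℝ) (p : Plane × Plane) : ℝ :=
  Real.sqrt (eps F p * (metric F p).det)

namespace IsLocalMetric

variable {U : Set (Plane × Plane)} {F : Plane × Plane → ℝ} {p : Plane × Plane}

theorem eps_mul_eps (hF : IsLocalMetric U F) (hp : p ∈ U) : eps F p * eps F p = 1 := by
  rcases Real.sign_apply_eq_of_ne_zero _ (hF.det_ne_zero p hp) with h | h <;> simp [eps, h]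

theorem eps_mul_det_pos (hF : IsLocalMetric U F) (hp : p ∈ U) :
    0 < eps F p * (metric F p).det := by
  rw [eps]
  exact Real.sign_mul_pos_of_ne_zero _ (hF.det_ne_zero p hp)

theorem density_ne_zero (hF : IsLocalMetric U F) (hp : p ∈ U) : density F p ≠ 0 :=
  (Real.sqrt_pos.2 (hF.eps_mul_det_pos hp)).ne'

theorem density_sq (hF : IsLocalMetric U F) (hp : p ∈ U) :
    density F p ^ 2 = eps F p * (metric F p).det :=
  Real.sq_sqrt (hF.eps_mul_det_pos hp).le

/-- The determinant is continuous and nonzero, so its sign is locally constant. This lets `ε` be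
treated as a constant under every derivative. -/
theorem eps_eventuallyEq (hF : IsLocalMetric U F) (hp : p ∈ U) :
    eps F =ᶠ[nhds p] fun _ => eps F p := by
  have hc : ContinuousAt (fun q => (metric F q).det) p :=
    (hF.homog_det.differentiableAt hF.isOpen hp).continuousAt
  rcases lt_or_gt_of_ne (hF.det_ne_zero p hp) with h | h
  · filter_upwards [hc.eventually (gt_mem_nhds h)] with q hq
    simp [eps, Real.sign_of_neg h, Real.sign_of_neg hq]
  · filter_upwards [hc.eventually (lt_mem_nhds h)] with q hq
    simp [eps, Real.sign_of_pos h, Real.sign_of_pos hq]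

theorem dotD_eps (hF : IsLocalMetric U F) (hp : p ∈ U) (i : Fin 2) : dotD i (eps F) p = 0 := by
  simp [dotD, (hF.eps_eventuallyEq hp).fderiv_eq]

theorem homog_eps (hF : IsLocalMetric U F) : IsHomog U 0 (eps F) :=
  .of_dotD_eq_zero (fun _ hp =>
    (contDiffAt_const.congr_of_eventuallyEq (hF.eps_eventuallyEq hp)).contDiffWithinAt)
    fun _ hp i => hF.dotD_eps hp i

theorem homog_ellLow (hF : IsLocalMetric U F) (i : Fin 2) : IsHomog U 0 (ellLow F i) :=
  hF.homog.dotD hF.isOpen i (by norm_num)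

theorem homog_ellUp (hF : IsLocalMetric U F) (i : Fin 2) : IsHomog U 0 (ellUp F i) :=
  (IsHomog.snd i).div hF.homog hF.isOpen (fun _ hq => hF.ne_zero hq) (by norm_num)

theorem mLow_zero : mLow F 0 p = -(density F p * ellUp F 1 p) := by simp [mLow, density]

theorem mLow_one : mLow F 1 p = density F p * ellUp F 0 p := by simp [mLow, density]

theorem mUp_zero : mUp F 0 p = -(eps F p / density F p * ellLow F 1 p) := by simp [mUp, density]

theorem mUp_one : mUp F 1 p = eps F p / density F p * ellLow F 0 p := by simp [mUp, density]

theorem mul_ellUp (hF : IsLocalMetric U F) (hp : p ∈ U) (i : Fin 2) :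
    F p * ellUp F i p = p.2 i := by
  rw [ellUp, mul_div_cancel₀ _ (hF.ne_zero hp)]

theorem ellLow_ellUp (hF : IsLocalMetric U F) (hp : p ∈ U) :
    ellLow F 0 p * ellUp F 0 p + ellLow F 1 p * ellUp F 1 p = 1 := by
  have e := hF.homog.euler p hp
  refine mul_left_cancel₀ (hF.ne_zero hp) ?_
  simp only [ellLow]
  linear_combination dotD 0 F p * hF.mul_ellUp hp 0 + dotD 1 F p * hF.mul_ellUp hp 1 + e

theorem mLow_mUp (hF : IsLocalMetric U F) (hp : p ∈ U) :
    mLow F 0 p * mUp F 0 p + mLow F 1 p * mUp F 1 p = eps F p := by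
  have := hF.density_ne_zero hp
  rw [mLow_zero, mLow_one, mUp_zero, mUp_one]
  field_simp
  linear_combination eps F p * hF.ellLow_ellUp hp

theorem mLow_ellUp : mLow F 0 p * ellUp F 0 p + mLow F 1 p * ellUp F 1 p = 0 := by
  rw [mLow_zero, mLow_one]; ring

theorem ellLow_mUp : ellLow F 0 p * mUp F 0 p + ellLow F 1 p * mUp F 1 p = 0 := by
  rw [mUp_zero, mUp_one]; ring

theorem frame_det (hF : IsLocalMetric U F) (hp : p ∈ U) :
    ellLow F 0 p * mLow F 1 p - ellLow F 1 p * mLow F 0 p = density F p := by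
  rw [mLow_zero, mLow_one]
  linear_combination density F p * hF.ellLow_ellUp hp

theorem metric_eq_dotD_ellLow (hF : IsLocalMetric U F) (hp : p ∈ U) (i j : Fin 2) :
    metric F p i j = ellLow F i p * ellLow F j p + F p * dotD i (ellLow F j) p := by
  have d := hF.homog.differentiableAt hF.isOpen hp
  have dl := (hF.homog_ellLow j).differentiableAt hF.isOpen hp
  have e : ∀ q ∈ U, dotD j (fun q => F q ^ 2) q = 2 * (F q * ellLow F j q) := fun q hq => by
    rw [dotD_sq (hF.homog.differentiableAt hF.isOpen hq), ellLow]; ring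
  simp only [metric, Matrix.of_apply]
  rw [dotD_congr hF.isOpen e hp, dotD_const_mul (d.fun_mul dl), dotD_mul d dl,
    show dotD i F p = ellLow F i p from rfl]
  ring

/-- The decomposition `g_ij = ℓ_i ℓ_j + ε m_i m_j`. -/
theorem metric_eq (hF : IsLocalMetric U F) (hp : p ∈ U) (i j : Fin 2) :
    metric F p i j = ellLow F i p * ellLow F j p + eps F p * (mLow F i p * mLow F j p) := by
  have e := hF.sum_metric_snd hp
  simp only [← hF.mul_ellUp hp] at e
  have e : ∀ i, metric F p i 0 * ellUp F 0 p + metric F p i 1 * ellUp F 1 p = ellLow F i p :=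
    fun i => mul_left_cancel₀ (hF.ne_zero hp) (by rw [ellLow]; linear_combination e i)
  have hd := hF.density_sq hp
  rw [Matrix.det_fin_two] at hd
  have c := hF.metric_comm hp 0 1
  have ee := hF.eps_mul_eps hp
  have hl := hF.ellLow_ellUp hp
  have e0 := e 0
  have e1 := e 1
  have hdd : eps F p * density F p ^ 2 =
      metric F p 0 0 * metric F p 1 1 - metric F p 0 1 * metric F p 1 0 := by
    rw [hd]; linear_combination (metric F p 0 0 * metric F p 1 1
      - metric F p 0 1 * metric F p 1 0) * ee
  rw [← e0, ← e1] at hl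
  -- For a symmetric 2×2 matrix `g` and a vector `ℓ` with `g(ℓ, ℓ) = 1`, one has `g = (gℓ)(gℓ)ᵀ +
  -- det g · ℓ^⊥ (ℓ^⊥)ᵀ` with `ℓ^⊥ = (-ℓ², ℓ¹)`. Here `gℓ` is `ℓ_i`, and `det g = ε · density²`
  -- turns the second summand into `ε m_i m_j`.
  have key : metric F p i j = (metric F p i 0 * ellUp F 0 p + metric F p i 1 * ellUp F 1 p) *
      (metric F p j 0 * ellUp F 0 p + metric F p j 1 * ellUp F 1 p) +
      (metric F p 0 0 * metric F p 1 1 - metric F p 0 1 * metric F p 1 0) *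
        (![-ellUp F 1 p, ellUp F 0 p] i * ![-ellUp F 1 p, ellUp F 0 p] j) := by
    rw [← c] at hl ⊢
    fin_cases i <;> fin_cases j <;> simp <;> try rw [← c]
    · linear_combination -metric F p 0 0 * hl
    · linear_combination -metric F p 0 1 * hl
    · linear_combination -metric F p 0 1 * hl
    · linear_combination -metric F p 1 1 * hl
  rw [e, e, ← hdd] at key
  rw [key]
  fin_cases i <;> fin_cases j <;> simp [mLow_zero, mLow_one] <;> ring

theorem mul_dotD_ellLow (hF : IsLocalMetric U F) (hp : p ∈ U) (i j : Fin 2) :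
    F p * dotD i (ellLow F j) p = eps F p * (mLow F i p * mLow F j p) := by
  linear_combination hF.metric_eq hp i j - hF.metric_eq_dotD_ellLow hp i j

end IsLocalMetric

/-! ### The derivation `v2` -/

section

variable {F h k : Plane × Plane → ℝ} {p : Plane × Plane}

theorem v2_eq : v2 F h p = eps F p * F p * (dotD 0 h p * mUp F 0 p + dotD 1 h p * mUp F 1 p) := by
  simp [v2]

theorem v2_congr {U : Set (Plane × Plane)} (hU : IsOpen U) (hhk : ∀ q ∈ U, h q = k q)
    (hp : p ∈ U) : v2 F h p = v2 F k p := by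
  simp only [v2_eq, dotD_congr hU hhk hp]

theorem v2_add (hh : DifferentiableAt ℝ h p) (hk : DifferentiableAt ℝ k p) :
    v2 F (fun q => h q + k q) p = v2 F h p + v2 F k p := by
  simp only [v2_eq, dotD_add hh hk]; ring

theorem v2_sub (hh : DifferentiableAt ℝ h p) (hk : DifferentiableAt ℝ k p) :
    v2 F (fun q => h q - k q) p = v2 F h p - v2 F k p := by
  simp only [v2_eq, dotD_sub hh hk]; ring

theorem v2_mul (hh : DifferentiableAt ℝ h p) (hk : DifferentiableAt ℝ k p) :
    v2 F (fun q => h q * k q) p = v2 F h p * k p + h p * v2 F k p := by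
  simp only [v2_eq, dotD_mul hh hk]; ring

theorem v2_const_mul (hk : DifferentiableAt ℝ k p) (c : ℝ) :
    v2 F (fun q => c * k q) p = c * v2 F k p := by
  simp only [v2_eq, dotD_const_mul hk]; ring

theorem v2_eq_zero_of_dotD (hh : ∀ i, dotD i h p = 0) : v2 F h p = 0 := by
  simp [v2_eq, hh]

end

namespace IsLocalMetric

variable {U : Set (Plane × Plane)} {F h : Plane × Plane → ℝ} {p : Plane × Plane} {r : ℝ}

theorem v2_eps (hF : IsLocalMetric U F) (hp : p ∈ U) : v2 F (eps F) p = 0 :=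
  v2_eq_zero_of_dotD fun i => hF.dotD_eps hp i

theorem v2_self : v2 F F p = 0 := by
  have := ellLow_mUp (F := F) (p := p)
  rw [v2_eq]
  simp only [ellLow] at this
  rw [this, mul_zero]

/-- `F ∂h/∂yʲ = r h ℓ_j + h_{;2} m_j` for `r`-homogeneous functions `h`. -/
theorem mul_dotD (hF : IsLocalMetric U F) (hh : IsHomog U r h) (hp : p ∈ U) (j : Fin 2) :
    F p * dotD j h p = r * h p * ellLow F j p + v2 F h p * mLow F j p := by
  have e := hh.euler p hp
  rw [← hF.mul_ellUp hp, ← hF.mul_ellUp hp] at e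
  have hl := hF.ellLow_ellUp hp
  have ee := hF.eps_mul_eps hp
  have hs := mul_inv_cancel₀ (hF.density_ne_zero hp)
  have h2 : v2 F h p * density F p = F p * (dotD 1 h p * ellLow F 0 p
      - dotD 0 h p * ellLow F 1 p) := by
    rw [v2_eq, mUp_zero, mUp_one, div_eq_mul_inv]
    linear_combination F p * (dotD 1 h p * ellLow F 0 p - dotD 0 h p * ellLow F 1 p)
      * (density F p * (density F p)⁻¹ * ee + hs)
  fin_cases j <;> simp [mLow_zero, mLow_one]
  · linear_combination ellLow F 0 p * e + ellUp F 1 p * h2 - F p * dotD 0 h p * hl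
  · linear_combination ellLow F 1 p * e - ellUp F 0 p * h2 - F p * dotD 1 h p * hl

/-- Apply the derivation to `F ℓⁱ = yⁱ`: it kills `F`, because `ℓ_i mⁱ = 0`, and sends `yⁱ` to `ε F
mⁱ`. -/
theorem v2_ellUp (hF : IsLocalMetric U F) (hp : p ∈ U) (i : Fin 2) :
    v2 F (ellUp F i) p = eps F p * mUp F i p := by
  have d := (hF.homog_ellUp i).differentiableAt hF.isOpen hp
  have e : v2 F (fun q => F q * ellUp F i q) p = v2 F (fun q => q.2 i) p :=
    v2_congr hF.isOpen (fun q hq => hF.mul_ellUp hq i) hp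
  rw [v2_mul (hF.homog.differentiableAt hF.isOpen hp) d, v2_self, v2_eq (h := fun q => q.2 i)] at e
  refine mul_left_cancel₀ (hF.ne_zero hp) ?_
  fin_cases i
  · simp [dotD_snd] at e
    simp only [Fin.zero_eta]
    linear_combination e
  · simp [dotD_snd] at e
    simp only [Fin.mk_one]
    linear_combination e

theorem v2_ellLow (hF : IsLocalMetric U F) (hp : p ∈ U) (i : Fin 2) :
    v2 F (ellLow F i) p = eps F p * mLow F i p := by
  have e0 := hF.mul_dotD_ellLow hp 0 i
  have e1 := hF.mul_dotD_ellLow hp 1 i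
  have ee := hF.eps_mul_eps hp
  rw [v2_eq]
  linear_combination eps F p * mUp F 0 p * e0 + eps F p * mUp F 1 p * e1
    + eps F p ^ 2 * mLow F i p * hF.mLow_mUp hp + eps F p * mLow F i p * ee

end IsLocalMetric

namespace IsLocalRiemannian

variable {U : Set (Plane × Plane)} {F h : Plane × Plane → ℝ} {p : Plane × Plane} {r : ℝ}

theorem dotD_det (hF : IsLocalRiemannian U F) (hp : p ∈ U) (k : Fin 2) :
    dotD k (fun q => (metric F q).det) p = 0 := by
  have d := fun i j => (hF.homog_metric i j).differentiableAt hF.isOpen hp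
  have h0 := hF.dotD_metric p hp
  rw [dotD_congr hF.isOpen (fun q _ => Matrix.det_fin_two (metric F q)) hp,
    dotD_sub ((d 0 0).fun_mul (d 1 1)) ((d 0 1).fun_mul (d 1 0)), dotD_mul (d 0 0) (d 1 1),
    dotD_mul (d 0 1) (d 1 0), h0, h0, h0, h0]
  ring

theorem contDiffOn_density (hF : IsLocalMetric U F) : ContDiffOn ℝ ∞ (density F) U :=
  (hF.homog_eps.smooth.mul hF.homog_det.smooth).sqrt fun _ hq => (hF.eps_mul_det_pos hq).ne'

theorem dotD_density (hF : IsLocalRiemannian U F) (hp : p ∈ U) (k : Fin 2) :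
    dotD k (density F) p = 0 := by
  have d := differentiableAt_of_contDiffOn hF.isOpen (contDiffOn_density hF.toIsLocalMetric) hp
  have e := dotD_congr hF.isOpen (fun q hq => hF.density_sq hq) hp k
  rw [dotD_sq d, dotD_mul (hF.homog_eps.differentiableAt hF.isOpen hp)
    (hF.homog_det.differentiableAt hF.isOpen hp), hF.dotD_eps hp, hF.dotD_det hp] at e
  have := hF.density_ne_zero hp
  simpa [this] using e

theorem homog_density (hF : IsLocalRiemannian U F) : IsHomog U 0 (density F) :=
  .of_dotD_eq_zero (contDiffOn_density hF.toIsLocalMetric) fun _ hq k => hF.dotD_density hq k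

theorem homog_mLow (hF : IsLocalRiemannian U F) (i : Fin 2) : IsHomog U 0 (mLow F i) := by
  have h := fun j => hF.homog_density.mul (hF.homog_ellUp j) hF.isOpen (t := 0) (by norm_num)
  fin_cases i
  · exact ((h 1).const_mul hF.isOpen (-1)).congr hF.isOpen fun _ _ => by
      simp [IsLocalMetric.mLow_zero]
  · exact (h 0).congr hF.isOpen fun _ _ => IsLocalMetric.mLow_one

theorem homog_eps_div_density (hF : IsLocalRiemannian U F) :
    IsHomog U 0 (fun q => eps F q / density F q) :=
  hF.homog_eps.div hF.homog_density hF.isOpen (fun _ hq => hF.density_ne_zero hq) (by norm_num)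

theorem homog_mUp (hF : IsLocalRiemannian U F) (i : Fin 2) : IsHomog U 0 (mUp F i) := by
  have h := fun j => hF.homog_eps_div_density.mul (hF.homog_ellLow j) hF.isOpen
    (t := 0) (by norm_num)
  fin_cases i
  · exact ((h 1).const_mul hF.isOpen (-1)).congr hF.isOpen fun _ _ => by
      simp [IsLocalMetric.mUp_zero]
  · exact (h 0).congr hF.isOpen fun _ _ => IsLocalMetric.mUp_one

theorem homog_v2 (hF : IsLocalRiemannian U F) (hh : IsHomog U r h) : IsHomog U r (v2 F h) := by
  have hd := fun i => (hh.dotD hF.isOpen i rfl).mul (hF.homog_mUp i) hF.isOpen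
    (t := r - 1) (by norm_num)
  exact ((hF.homog_eps.mul hF.homog hF.isOpen rfl).mul ((hd 0).add (hd 1) hF.isOpen) hF.isOpen
    (by ring)).congr hF.isOpen fun _ _ => v2_eq

theorem v2_density (hF : IsLocalRiemannian U F) (hp : p ∈ U) : v2 F (density F) p = 0 :=
  v2_eq_zero_of_dotD fun i => hF.dotD_density hp i

/-- The covector `m` is the rotated `ℓⁱ` times the density. The density is constant on fibres
because the metric tensor is, so only `ℓⁱ_{;2} = ε mⁱ` contributes. Together with `v2_mUp`, this is
where the pseudo-Riemannian hypothesis enters the frame equations. -/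
theorem v2_mLow (hF : IsLocalRiemannian U F) (hp : p ∈ U) (i : Fin 2) :
    v2 F (mLow F i) p = -ellLow F i p := by
  have dd := hF.homog_density.differentiableAt hF.isOpen hp
  have dl := fun j => (hF.homog_ellUp j).differentiableAt hF.isOpen hp
  have ee := hF.eps_mul_eps hp
  have hs := mul_inv_cancel₀ (hF.density_ne_zero hp)
  have e := fun j => v2_mul (F := F) dd (dl j)
  simp only [hF.v2_density hp, hF.v2_ellUp hp] at e
  fin_cases i
  · have : v2 F (mLow F 0) p = v2 F (fun q => -1 * (density F q * ellUp F 1 q)) p :=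
      v2_congr hF.isOpen (fun q _ => by rw [IsLocalMetric.mLow_zero]; ring) hp
    simp only [Fin.zero_eta]
    rw [this, v2_const_mul (dd.fun_mul (dl 1)), e 1, IsLocalMetric.mUp_one, div_eq_mul_inv]
    linear_combination -ellLow F 0 p * (density F p * (density F p)⁻¹ * ee + hs)
  · have : v2 F (mLow F 1) p = v2 F (fun q => density F q * ellUp F 0 q) p :=
      v2_congr hF.isOpen (fun q _ => by rw [IsLocalMetric.mLow_one]) hp
    simp only [Fin.mk_one]
    rw [this, e 0, IsLocalMetric.mUp_zero, div_eq_mul_inv]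
    linear_combination -ellLow F 1 p * (density F p * (density F p)⁻¹ * ee + hs)

theorem v2_mUp (hF : IsLocalRiemannian U F) (hp : p ∈ U) (i : Fin 2) :
    v2 F (mUp F i) p = -ellUp F i p := by
  have dd := hF.homog_density.differentiableAt hF.isOpen hp
  have dm := fun j => (hF.homog_mUp j).differentiableAt hF.isOpen hp
  have de := hF.homog_eps.differentiableAt hF.isOpen hp
  have dl := fun j => (hF.homog_ellLow j).differentiableAt hF.isOpen hp
  have ee := hF.eps_mul_eps hp
  have hs := hF.density_ne_zero hp
  refine mul_left_cancel₀ hs ?_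
  have e := v2_mul (F := F) dd (dm i)
  have e2 := fun j => v2_mul (F := F) de (dl j)
  simp only [hF.v2_density hp, hF.v2_eps hp, hF.v2_ellLow hp] at e e2
  fin_cases i
  · have : v2 F (fun q => density F q * mUp F 0 q) p
        = v2 F (fun q => -1 * (eps F q * ellLow F 1 q)) p :=
      v2_congr hF.isOpen (fun q hq => by
        have := hF.density_ne_zero hq
        rw [IsLocalMetric.mUp_zero]; field_simp) hp
    rw [v2_const_mul (de.fun_mul (dl 1)), e2 1, IsLocalMetric.mLow_one] at this
    simp at e ⊢
    linear_combination this - e - density F p * ellUp F 0 p * ee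
  · have : v2 F (fun q => density F q * mUp F 1 q) p
        = v2 F (fun q => eps F q * ellLow F 0 q) p :=
      v2_congr hF.isOpen (fun q hq => by
        have := hF.density_ne_zero hq
        rw [IsLocalMetric.mUp_one]; field_simp) hp
    rw [e2 0, IsLocalMetric.mLow_zero] at this
    simp at e ⊢
    linear_combination this - e - density F p * ellUp F 1 p * ee

/-- Second fibre derivatives of an `r`-homogeneous function in the Berwald frame. -/
theorem sq_mul_dotD_dotD (hF : IsLocalRiemannian U F) (hh : IsHomog U r h) (hp : p ∈ U)
    (j k : Fin 2) :
    F p ^ 2 * dotD k (dotD j h) p = r * (r - 1) * h p * (ellLow F j p * ellLow F k p)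
      + (r - 1) * v2 F h p * (ellLow F j p * mLow F k p + ellLow F k p * mLow F j p)
      + (v2 F (v2 F h) p + r * eps F p * h p) * (mLow F j p * mLow F k p) := by
  have hU := hF.isOpen
  have e1 := hF.mul_dotD hh hp j
  have e2 := hF.mul_dotD (hh.dotD hU j rfl) hp k
  have dF := hF.homog.differentiableAt hU hp
  have dh := hh.differentiableAt hU hp
  have dv := (hF.homog_v2 hh).differentiableAt hU hp
  have dj := (hh.dotD hU j rfl).differentiableAt hU hp
  have dl := (hF.homog_ellLow j).differentiableAt hU hp
  have dm := (hF.homog_mLow j).differentiableAt hU hp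
  -- The first-order expansion, applied to the `(r - 1)`-homogeneous function `∂_j h`, calls for
  -- `(∂_j h)_{;2}`. That is obtained by applying the derivation to the first-order expansion of `h`
  -- itself.
  have e3 : v2 F (fun q => F q * dotD j h q) p
      = v2 F (fun q => r * h q * ellLow F j q + v2 F h q * mLow F j q) p :=
    v2_congr hU (fun q hq => hF.mul_dotD hh hq j) hp
  rw [v2_mul dF dj, v2_add ((dh.const_mul r).fun_mul dl) (dv.fun_mul dm),
    v2_mul (dh.const_mul r) dl, v2_mul dv dm, v2_const_mul dh, IsLocalMetric.v2_self,
    hF.v2_ellLow hp, hF.v2_mLow hp] at e3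
  linear_combination F p * e2 + (r - 1) * ellLow F k p * e1 + mLow F k p * e3

/-- Third fibre derivatives of a `2`-homogeneous function in the Berwald frame. -/
theorem cube_mul_dotD_dotD_dotD (hF : IsLocalRiemannian U F) (hh : IsHomog U 2 h) (hp : p ∈ U)
    (j k i : Fin 2) :
    F p ^ 3 * dotD i (dotD k (dotD j h)) p
      = (v2 F (v2 F (v2 F h)) p + 4 * eps F p * v2 F h p)
        * (mLow F j p * mLow F k p * mLow F i p) := by
  have hU := hF.isOpen
  -- A second fibre derivative of a 2-homogeneous function has degree 0, so its gradient has no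
  -- `ℓ_i` component. In the derivative of the second-order expansion, all terms containing `ℓ_j` or
  -- `ℓ_k` cancel.
  have hH := (hh.dotD hU j rfl).dotD hU k (t := 0) (by norm_num)
  have e2 := hF.mul_dotD hH hp i
  have dF := hF.homog.differentiableAt hU hp
  have dh := hh.differentiableAt hU hp
  have dv := (hF.homog_v2 hh).differentiableAt hU hp
  have dvv := (hF.homog_v2 (hF.homog_v2 hh)).differentiableAt hU hp
  have de := hF.homog_eps.differentiableAt hU hp
  have dl := fun j => (hF.homog_ellLow j).differentiableAt hU hp
  have dm := fun j => (hF.homog_mLow j).differentiableAt hU hp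
  have e3 : v2 F (fun q => F q ^ 2 * dotD k (dotD j h) q) p
      = v2 F (fun q => 2 * h q * (ellLow F j q * ellLow F k q)
        + v2 F h q * (ellLow F j q * mLow F k q + ellLow F k q * mLow F j q)
        + (v2 F (v2 F h) q + 2 * (eps F q * h q)) * (mLow F j q * mLow F k q)) p :=
    v2_congr hU (fun q hq => by rw [hF.sq_mul_dotD_dotD hh hq]; ring) hp
  have dlm := fun j k => (dl j).fun_mul (dm k)
  have dF2 : v2 F (fun q => F q ^ 2) p = 0 := by
    simp only [pow_two]; rw [v2_mul dF dF, IsLocalMetric.v2_self]; ring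
  rw [v2_mul (dF.fun_pow 2) (hH.differentiableAt hU hp), dF2,
    v2_add (((dh.const_mul 2).fun_mul ((dl j).fun_mul (dl k))).fun_add
      (dv.fun_mul ((dlm j k).fun_add (dlm k j))))
      ((dvv.fun_add ((de.fun_mul dh).const_mul 2)).fun_mul ((dm j).fun_mul (dm k))),
    v2_add ((dh.const_mul 2).fun_mul ((dl j).fun_mul (dl k)))
      (dv.fun_mul ((dlm j k).fun_add (dlm k j))),
    v2_mul (dh.const_mul 2) ((dl j).fun_mul (dl k)), v2_const_mul dh, v2_mul (dl j) (dl k),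
    v2_mul dv ((dlm j k).fun_add (dlm k j)), v2_add (dlm j k) (dlm k j), v2_mul (dl j) (dm k),
    v2_mul (dl k) (dm j), v2_mul (dvv.fun_add ((de.fun_mul dh).const_mul 2))
      ((dm j).fun_mul (dm k)), v2_add dvv ((de.fun_mul dh).const_mul 2),
    v2_const_mul (de.fun_mul dh), v2_mul de dh, v2_mul (dm j) (dm k), hF.v2_eps hp] at e3
  simp only [hF.v2_ellLow hp, hF.v2_mLow hp] at e3
  linear_combination F p ^ 2 * e2 + mLow F i p * e3

end IsLocalRiemannian

/-! ### Anisotropic conformal changes in coordinates -/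

/-- Anisotropic conformal factors on an open set of coordinates. -/
structure IsLocalFactor (U : Set (Plane × Plane)) (F φ : Plane × Plane → ℝ) : Prop where
  homog : IsHomog U 0 φ
  ne_zero : ∀ p ∈ U, F p ^ 2 * (∑ i, ∑ j, (dotD i (dotD j φ) p + dotD i φ p * dotD j φ p)
    * mUp F i p * mUp F j p) + eps F p ≠ 0

/-- The local expression of `e^φ F`. -/
def expMul (φ F : Plane × Plane → ℝ) (p : Plane × Plane) : ℝ := Real.exp (φ p) * F p

/-- The vector `P ℓⁱ + Q mⁱ`, the difference of the sprays of `e^φ F` and `F`. -/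
def sprayDiff (F φ : Plane × Plane → ℝ) (i : Fin 2) (p : Plane × Plane) : ℝ :=
  P F φ p * ellUp F i p + Q F φ p * mUp F i p

section

variable {U : Set (Plane × Plane)} {F φ : Plane × Plane → ℝ} {p : Plane × Plane}

theorem IsLocalRiemannian.mainScalar_eq_zero (hF : IsLocalRiemannian U F) (hp : p ∈ U) :
    mainScalar F p = 0 := by
  simp [mainScalar, cartan, hF.dotD_metric p hp]

namespace IsLocalFactor

theorem delta_homog (hF : IsLocalRiemannian U F) (hφ : IsLocalFactor U F φ) (i : Fin 2) :
    IsHomog U 0 (delta F i φ) := by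
  have hU := hF.isOpen
  have h := fun j => ((hF.homog_spray j).dotD hU i rfl).mul (hφ.homog.dotD hU j rfl) hU
    (t := 0) (by norm_num)
  exact ((hφ.homog.baseD hU i).sub ((h 0).add (h 1) hU) hU).congr hU fun q _ => by
    simp [delta, barthel]

theorem h1_homog (hF : IsLocalRiemannian U F) (hφ : IsLocalFactor U F φ) :
    IsHomog U 0 (h1 F φ) := by
  have hU := hF.isOpen
  have h := fun i => (hφ.delta_homog hF i).mul (hF.homog_ellUp i) hU (t := 0) (by norm_num)
  exact ((h 0).add (h 1) hU).congr hU fun q _ => by simp [h1]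

theorem h2_homog (hF : IsLocalRiemannian U F) (hφ : IsLocalFactor U F φ) :
    IsHomog U 0 (h2 F φ) := by
  have hU := hF.isOpen
  have h := fun i => (hφ.delta_homog hF i).mul (hF.homog_mUp i) hU (t := 0) (by norm_num)
  exact (hF.homog_eps.mul ((h 0).add (h 1) hU) hU (by norm_num)).congr hU fun q _ => by simp [h2]

theorem delta_eq (hF : IsLocalRiemannian U F) (hp : p ∈ U) (φ : Plane × Plane → ℝ) (i : Fin 2) :
    delta F i φ p = h1 F φ p * ellLow F i p + h2 F φ p * mLow F i p := by
  have hl := hF.ellLow_ellUp hp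
  have ee := hF.eps_mul_eps hp
  have hs := mul_inv_cancel₀ (hF.density_ne_zero hp)
  simp only [h1, h2, Fin.sum_univ_two]
  have he : eps F p * (eps F p * (density F p)⁻¹) * density F p = 1 := by
    linear_combination density F p * (density F p)⁻¹ * ee + hs
  fin_cases i <;> simp [IsLocalMetric.mLow_zero, IsLocalMetric.mLow_one, IsLocalMetric.mUp_zero,
    IsLocalMetric.mUp_one, div_eq_mul_inv]
  · linear_combination (-delta F 0 φ p * ellLow F 1 p * ellUp F 1 p
      + delta F 1 φ p * ellLow F 0 p * ellUp F 1 p) * he - delta F 0 φ p * hl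
  · linear_combination (-delta F 1 φ p * ellLow F 0 p * ellUp F 0 p
      + delta F 0 φ p * ellLow F 1 p * ellUp F 0 p) * he - delta F 1 φ p * hl

theorem sigma_eq (hF : IsLocalRiemannian U F) (hp : p ∈ U) :
    sigma F φ p = v2 F (v2 F φ) p + 2 * v2 F φ p ^ 2 := by
  rw [sigma, hF.mainScalar_eq_zero hp]; ring

/-- Contracting the frame expansions of the first and second derivatives of `φ` with `mⁱ mʲ` turns
the quantity in the hypothesis into `φ_{;2;2} + (φ_{;2})² + ε`, which is `σ + ε - (φ_{;2})²` since
`ℐ = 0`. -/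
theorem rho_denom_ne_zero (hF : IsLocalRiemannian U F) (hφ : IsLocalFactor U F φ) (hp : p ∈ U) :
    sigma F φ p + eps F p - v2 F φ p ^ 2 ≠ 0 := by
  have h := hφ.ne_zero p hp
  simp only [Fin.sum_univ_two] at h
  have e1 := hF.mul_dotD hφ.homog hp
  have e2 := hF.sq_mul_dotD_dotD hφ.homog hp
  have ml := hF.mLow_mUp hp
  have ll := IsLocalMetric.ellLow_mUp (F := F) (p := p)
  have ee := hF.eps_mul_eps hp
  rw [sigma_eq hF hp]
  convert h using 1
  have key : ∀ i j, F p ^ 2 * ((dotD i (dotD j φ) p + dotD i φ p * dotD j φ p)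
      * mUp F i p * mUp F j p) = (-v2 F φ p * (ellLow F j p * mLow F i p
        + ellLow F i p * mLow F j p) + (v2 F (v2 F φ) p + v2 F φ p ^ 2)
        * (mLow F i p * mLow F j p)) * mUp F i p * mUp F j p := by
    intro i j
    linear_combination mUp F i p * mUp F j p * (e2 j i + F p * dotD i φ p * e1 j
      + v2 F φ p * mLow F j p * e1 i)
  have s : ∀ a b c d f : ℝ, f * (a + b + (c + d)) = f * a + f * b + (f * c + f * d) := by
    intros; ring
  rw [s, key, key, key, key]
  linear_combination 2 * v2 F φ p * (mLow F 0 p * mUp F 0 p + mLow F 1 p * mUp F 1 p) * ll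
    - (v2 F (v2 F φ) p + v2 F φ p ^ 2) * ((mLow F 0 p * mUp F 0 p + mLow F 1 p * mUp F 1 p
      + eps F p) * ml + ee)

theorem sigma_homog (hF : IsLocalRiemannian U F) (hφ : IsLocalFactor U F φ) :
    IsHomog U 0 (sigma F φ) := by
  have hU := hF.isOpen
  have hv := hF.homog_v2 hφ.homog
  exact ((hF.homog_v2 hv).add ((hv.sq hU (by norm_num)).const_mul hU 2) hU).congr hU
    fun q hq => sigma_eq hF hq

theorem rho_homog (hF : IsLocalRiemannian U F) (hφ : IsLocalFactor U F φ) :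
    IsHomog U 0 (rho F φ) := by
  have hU := hF.isOpen
  exact (IsHomog.const 1).div (((hφ.sigma_homog hF).add hF.homog_eps hU).sub
    ((hF.homog_v2 hφ.homog).sq hU (by norm_num)) hU) hU
    (fun q hq => hφ.rho_denom_ne_zero hF hq) (by norm_num)

theorem inner_homog (hF : IsLocalRiemannian U F) (hφ : IsLocalFactor U F φ) :
    IsHomog U 0 (fun q => v2 F φ q * h1 F φ q + v2 F (h1 F φ) q - 2 * h2 F φ q) := by
  have hU := hF.isOpen
  exact (((hF.homog_v2 hφ.homog).mul (hφ.h1_homog hF) hU (by norm_num)).add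
    (hF.homog_v2 (hφ.h1_homog hF)) hU).sub ((hφ.h2_homog hF).const_mul hU 2) hU

theorem Q_homog (hF : IsLocalRiemannian U F) (hφ : IsLocalFactor U F φ) :
    IsHomog U 2 (Q F φ) := by
  have hU := hF.isOpen
  exact ((((hF.homog_eps.mul (hφ.rho_homog hF) hU (t := 0) (by norm_num)).mul hF.homog_sq hU
    (t := 2) (by norm_num)).mul (hφ.inner_homog hF) hU (by norm_num))).const_mul hU (1 / 2)

theorem P_homog (hF : IsLocalRiemannian U F) (hφ : IsLocalFactor U F φ) :
    IsHomog U 2 (P F φ) := by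
  have hU := hF.isOpen
  exact (((((((hφ.rho_homog hF).mul hF.homog_sq hU (t := 2) (by norm_num)).mul
    (hF.homog_v2 hφ.homog) hU (t := 2) (by norm_num)).mul (hφ.inner_homog hF) hU (t := 2)
      (by norm_num)).const_mul hU (-1)).add (hF.homog_sq.mul (hφ.h1_homog hF) hU (by norm_num))
        hU).const_mul hU (1 / 2)).congr hU fun q _ => by rw [P]; ring

theorem sprayDiff_homog (hF : IsLocalRiemannian U F) (hφ : IsLocalFactor U F φ) (i : Fin 2) :
    IsHomog U 2 (sprayDiff F φ i) :=
  ((hφ.P_homog hF).mul (hF.homog_ellUp i) hF.isOpen (by norm_num)).add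
    ((hφ.Q_homog hF).mul (hF.homog_mUp i) hF.isOpen (by norm_num)) hF.isOpen

/-- In the frame `(ℓⁱ, mⁱ)` the derivation acts on components by `(P, Q) ↦ (P_{;2} - Q, εP +
Q_{;2})`. The next two lemmas iterate this rule. -/
theorem v2_sprayDiff (hF : IsLocalRiemannian U F) (hφ : IsLocalFactor U F φ) (hp : p ∈ U)
    (i : Fin 2) : v2 F (sprayDiff F φ i) p = (v2 F (P F φ) p - Q F φ p) * ellUp F i p
      + (eps F p * P F φ p + v2 F (Q F φ) p) * mUp F i p := by
  have dP := (hφ.P_homog hF).differentiableAt hF.isOpen hp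
  have dQ := (hφ.Q_homog hF).differentiableAt hF.isOpen hp
  have dl := (hF.homog_ellUp i).differentiableAt hF.isOpen hp
  have dm := (hF.homog_mUp i).differentiableAt hF.isOpen hp
  unfold sprayDiff
  rw [v2_add (dP.fun_mul dl) (dQ.fun_mul dm), v2_mul dP dl, v2_mul dQ dm, hF.v2_ellUp hp,
    hF.v2_mUp hp]
  ring

theorem v2_v2_sprayDiff (hF : IsLocalRiemannian U F) (hφ : IsLocalFactor U F φ) (hp : p ∈ U)
    (i : Fin 2) : v2 F (v2 F (sprayDiff F φ i)) p
      = (v2 F (v2 F (P F φ)) p - 2 * v2 F (Q F φ) p - eps F p * P F φ p) * ellUp F i p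
      + (2 * (eps F p * v2 F (P F φ) p) - eps F p * Q F φ p + v2 F (v2 F (Q F φ)) p)
        * mUp F i p := by
  have hU := hF.isOpen
  have dP := (hφ.P_homog hF).differentiableAt hU hp
  have dQ := (hφ.Q_homog hF).differentiableAt hU hp
  have dvP := (hF.homog_v2 (hφ.P_homog hF)).differentiableAt hU hp
  have dvQ := (hF.homog_v2 (hφ.Q_homog hF)).differentiableAt hU hp
  have dl := (hF.homog_ellUp i).differentiableAt hU hp
  have dm := (hF.homog_mUp i).differentiableAt hU hp
  have de := hF.homog_eps.differentiableAt hU hp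
  rw [v2_congr hU (fun q hq => hφ.v2_sprayDiff hF hq i) hp,
    v2_add ((dvP.fun_sub dQ).fun_mul dl) (((de.fun_mul dP).fun_add dvQ).fun_mul dm),
    v2_mul (dvP.fun_sub dQ) dl, v2_mul ((de.fun_mul dP).fun_add dvQ) dm, v2_sub dvP dQ,
    v2_add (de.fun_mul dP) dvQ, v2_mul de dP, hF.v2_ellUp hp, hF.v2_mUp hp, hF.v2_eps hp]
  ring

theorem v2_v2_v2_sprayDiff (hF : IsLocalRiemannian U F) (hφ : IsLocalFactor U F φ) (hp : p ∈ U)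
    (i : Fin 2) : v2 F (v2 F (v2 F (sprayDiff F φ i))) p
      = (v2 F (v2 F (v2 F (P F φ))) p - 3 * v2 F (v2 F (Q F φ)) p
          - 3 * eps F p * v2 F (P F φ) p + eps F p * Q F φ p) * ellUp F i p
      + (3 * eps F p * v2 F (v2 F (P F φ)) p - 3 * eps F p * v2 F (Q F φ) p - P F φ p
          + v2 F (v2 F (v2 F (Q F φ))) p) * mUp F i p := by
  have hU := hF.isOpen
  have dP := (hφ.P_homog hF).differentiableAt hU hp
  have dQ := (hφ.Q_homog hF).differentiableAt hU hp
  have dvP := (hF.homog_v2 (hφ.P_homog hF)).differentiableAt hU hp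
  have dvQ := (hF.homog_v2 (hφ.Q_homog hF)).differentiableAt hU hp
  have dvvP := (hF.homog_v2 (hF.homog_v2 (hφ.P_homog hF))).differentiableAt hU hp
  have dvvQ := (hF.homog_v2 (hF.homog_v2 (hφ.Q_homog hF))).differentiableAt hU hp
  have dl := (hF.homog_ellUp i).differentiableAt hU hp
  have dm := (hF.homog_mUp i).differentiableAt hU hp
  have de := hF.homog_eps.differentiableAt hU hp
  have d1 := (dvvP.fun_sub (dvQ.const_mul 2)).fun_sub (de.fun_mul dP)
  have d2 := (((de.fun_mul dvP).const_mul 2).fun_sub (de.fun_mul dQ)).fun_add dvvQ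
  rw [v2_congr hU (fun q hq => hφ.v2_v2_sprayDiff hF hq i) hp,
    v2_add (d1.fun_mul dl) (d2.fun_mul dm), v2_mul d1 dl, v2_mul d2 dm,
    v2_sub (dvvP.fun_sub (dvQ.const_mul 2)) (de.fun_mul dP), v2_sub dvvP (dvQ.const_mul 2),
    v2_const_mul dvQ, v2_mul de dP,
    v2_add (((de.fun_mul dvP).const_mul 2).fun_sub (de.fun_mul dQ)) dvvQ,
    v2_sub ((de.fun_mul dvP).const_mul 2) (de.fun_mul dQ), v2_const_mul (de.fun_mul dvP),
    v2_mul de dvP, v2_mul de dQ, hF.v2_ellUp hp, hF.v2_mUp hp, hF.v2_eps hp]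
  linear_combination (-(P F φ p * mUp F i p)) * hF.eps_mul_eps hp

/-- `Mⁱ_jk` is the fibrewise Hessian of the difference of the sprays. -/
theorem Mexpr_eq (hF : IsLocalRiemannian U F) (hφ : IsLocalFactor U F φ) (hp : p ∈ U)
    (i j k : Fin 2) : Mexpr F φ i j k p = dotD k (dotD j (sprayDiff F φ i)) p := by
  have h0 := hF.ne_zero hp
  have e := hF.sq_mul_dotD_dotD (hφ.sprayDiff_homog hF i) hp j k
  rw [hφ.v2_v2_sprayDiff hF hp, hφ.v2_sprayDiff hF hp, sprayDiff] at e
  refine mul_left_cancel₀ (pow_ne_zero 2 h0) ?_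
  rw [e, Mexpr, ← mul_assoc, mul_one_div_cancel (pow_ne_zero 2 h0)]
  -- The Hessian formula with `r = 2` adds `2ε Dⁱ` to `Dⁱ_{;2;2}`, which turns the terms `-εP` and
  -- `-εQ` into the `+εP` and `+εQ` of `M`.
  ring

/-- The fibre derivatives of `Mⁱ_jk` vanish iff the identities between `P` and `Q` hold. -/
theorem identities_iff (hF : IsLocalRiemannian U F) (hφ : IsLocalFactor U F φ) (hp : p ∈ U) :
    ((-3 * eps F p * Q F φ p - 3 * v2 F (v2 F (Q F φ)) p + eps F p * v2 F (P F φ) p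
      + v2 F (v2 F (v2 F (P F φ))) p = 0) ∧
    (3 * P F φ p + 3 * eps F p * v2 F (v2 F (P F φ)) p + eps F p * v2 F (Q F φ) p
      + v2 F (v2 F (v2 F (Q F φ))) p = 0)) ↔
    ∀ i j k r, dotD r (dotD k (dotD j (sprayDiff F φ i))) p = 0 := by
  have h0 := hF.ne_zero hp
  have ee := hF.eps_mul_eps hp
  have e := fun i j k r => hF.cube_mul_dotD_dotD_dotD (hφ.sprayDiff_homog hF i) hp j k r
  simp only [hφ.v2_v2_v2_sprayDiff hF hp, hφ.v2_sprayDiff hF hp] at e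
  constructor
  · rintro ⟨ha, hb⟩ i j k r
    refine (mul_eq_zero.1 ((e i j k r).trans ?_)).resolve_left (pow_ne_zero 3 h0)
    linear_combination (mLow F j p * mLow F k p * mLow F r p) * (ellUp F i p * ha + mUp F i p * hb
      + 4 * P F φ p * mUp F i p * ee)
  · intro h
    -- Since `ℓ ∧ m` is the density, `m` has a nonzero component `m_j`. The component `jjj` of the
    -- third derivative then isolates the vector `X ℓⁱ + Y mⁱ`.
    have hm : ∃ j, mLow F j p ≠ 0 := by
      by_contra! hm
      have := hF.frame_det hp
      rw [hm, hm] at this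
      exact hF.density_ne_zero hp (by linear_combination -this)
    obtain ⟨j, hj⟩ := hm
    have hi : ∀ i, _ := fun i => (mul_eq_zero.1 ((e i j j j).symm.trans
      (by rw [h, mul_zero]))).resolve_right (by positivity)
    have hl := hF.ellLow_ellUp hp
    have hlm := IsLocalMetric.ellLow_mUp (F := F) (p := p)
    have hml := IsLocalMetric.mLow_ellUp (F := F) (p := p)
    have hmm := hF.mLow_mUp hp
    have i0 := hi 0
    have i1 := hi 1
    set X := v2 F (v2 F (v2 F (P F φ))) p - 3 * v2 F (v2 F (Q F φ)) p
      - 3 * eps F p * v2 F (P F φ) p + eps F p * Q F φ p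
      + 4 * eps F p * (v2 F (P F φ) p - Q F φ p) with hX
    set Y := 3 * eps F p * v2 F (v2 F (P F φ)) p - 3 * eps F p * v2 F (Q F φ) p - P F φ p
      + v2 F (v2 F (v2 F (Q F φ))) p + 4 * eps F p * (eps F p * P F φ p + v2 F (Q F φ) p) with hY
    -- Pairing the vector with `ℓ_i` gives `X`, and pairing it with `ε m_i` gives `Y`. Up to `ε² =
    -- 1` these are the left sides of the two identities.
    have hX0 : X = 0 := by
      linear_combination ellLow F 0 p * i0 + ellLow F 1 p * i1 - X * hl - Y * hlm
    have hY0 : Y = 0 := by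
      linear_combination eps F p * (mLow F 0 p * i0 + mLow F 1 p * i1) - eps F p * X * hml
        - eps F p * Y * hmm - Y * ee
    exact ⟨by linear_combination hX0, by linear_combination hY0 - 4 * P F φ p * ee⟩

end IsLocalFactor

end

/-! ### The metric `e^φ F` and its geodesic spray -/

namespace IsLocalFactor

variable {U : Set (Plane × Plane)} {F φ : Plane × Plane → ℝ} {p : Plane × Plane}

theorem expMul_homog (hF : IsLocalRiemannian U F) (hφ : IsLocalFactor U F φ) :
    IsHomog U 1 (expMul φ F) :=
  (hφ.homog.exp hF.isOpen).mul hF.homog hF.isOpen (by norm_num)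

theorem expMul_sq_homog (hF : IsLocalRiemannian U F) (hφ : IsLocalFactor U F φ) :
    IsHomog U 2 (fun q => expMul φ F q ^ 2) :=
  (hφ.expMul_homog hF).sq hF.isOpen (by norm_num)

theorem v2_expMul_sq (hF : IsLocalRiemannian U F) (hφ : IsLocalFactor U F φ) (hp : p ∈ U) :
    v2 F (fun q => expMul φ F q ^ 2) p = 2 * (v2 F φ p * expMul φ F p ^ 2) := by
  have d := hφ.homog.differentiableAt hF.isOpen hp
  have dF := hF.homog.differentiableAt hF.isOpen hp
  have e : v2 F (fun q => Real.exp (φ q)) p = Real.exp (φ p) * v2 F φ p := by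
    simp only [v2_eq, dotD_exp d]; ring
  have e1 : v2 F (expMul φ F) p = v2 F φ p * expMul φ F p := by
    unfold expMul
    rw [v2_mul d.exp dF, e, IsLocalMetric.v2_self]; ring
  have db := (hφ.expMul_homog hF).differentiableAt hF.isOpen hp
  simp only [pow_two]
  rw [v2_mul db db, e1]
  ring

theorem v2_v2_expMul_sq (hF : IsLocalRiemannian U F) (hφ : IsLocalFactor U F φ) (hp : p ∈ U) :
    v2 F (v2 F (fun q => expMul φ F q ^ 2)) p
      = (2 * v2 F (v2 F φ) p + 4 * v2 F φ p ^ 2) * expMul φ F p ^ 2 := by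
  have d := (hF.homog_v2 hφ.homog).differentiableAt hF.isOpen hp
  have db := (hφ.expMul_sq_homog hF).differentiableAt hF.isOpen hp
  rw [v2_congr hF.isOpen (fun q hq => hφ.v2_expMul_sq hF hq) hp, v2_const_mul (d.fun_mul db),
    v2_mul d db, hφ.v2_expMul_sq hF hp]
  ring

/-- This is half the frame expansion of the Hessian of `F̄²`, using `(F̄²)_{;2} = 2 φ_{;2} F̄²`. In
the coframe `(ℓ, m)`, the matrix of `ḡ` is `e^{2φ}` times that with rows `(1, φ_{;2})` and `(φ_{;2},
σ + ε)`. -/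
theorem metric_expMul (hF : IsLocalRiemannian U F) (hφ : IsLocalFactor U F φ) (hp : p ∈ U)
    (i j : Fin 2) : metric (expMul φ F) p i j = Real.exp (φ p) ^ 2 *
      (ellLow F i p * ellLow F j p
        + v2 F φ p * (ellLow F i p * mLow F j p + ellLow F j p * mLow F i p)
        + (sigma F φ p + eps F p) * (mLow F i p * mLow F j p)) := by
  have h0 := hF.ne_zero hp
  have e := hF.sq_mul_dotD_dotD (hφ.expMul_sq_homog hF) hp j i
  rw [hφ.v2_v2_expMul_sq hF hp, hφ.v2_expMul_sq hF hp] at e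
  refine mul_left_cancel₀ (pow_ne_zero 2 h0) ?_
  rw [metric, Matrix.of_apply, sigma_eq hF hp]
  simp only [expMul] at e ⊢
  linear_combination (1 / 2) * e

theorem isLocalMetric_expMul (hF : IsLocalRiemannian U F) (hφ : IsLocalFactor U F φ) :
    IsLocalMetric U (expMul φ F) where
  isOpen := hF.isOpen
  snd_ne_zero := hF.snd_ne_zero
  homog := hφ.expMul_homog hF
  det_ne_zero p hp := by
    have h1 := hφ.rho_denom_ne_zero hF hp
    have h2 := hF.density_ne_zero hp
    have h3 := hF.frame_det hp
    have h4 := Real.exp_ne_zero (φ p)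
    -- The determinant of the coframe matrix times the square of `ℓ ∧ m`. Its middle factor is
    -- `1/ρ`, so the condition on `φ` is precisely non-degeneracy of `F̄`.
    have : (metric (expMul φ F) p).det = Real.exp (φ p) ^ 4 *
        (sigma F φ p + eps F p - v2 F φ p ^ 2) * density F p ^ 2 := by
      rw [Matrix.det_fin_two, hφ.metric_expMul hF hp, hφ.metric_expMul hF hp,
        hφ.metric_expMul hF hp, hφ.metric_expMul hF hp, ← h3]
      ring
    rw [this]
    positivity

/-- `δ_i F̄² = F² δ_i (e^{2φ})`. -/
theorem sq_mul_delta_exp (hF : IsLocalRiemannian U F) (hφ : IsLocalFactor U F φ) (hp : p ∈ U)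
    (i : Fin 2) : F p ^ 2 * delta F i (fun q => Real.exp (2 * φ q)) p
      = delta F i (fun q => expMul φ F q ^ 2) p := by
  have d := (hφ.homog.differentiableAt hF.isOpen hp).const_mul 2
  have dF := (hF.homog.differentiableAt hF.isOpen hp).fun_pow 2
  have e := hF.delta_sq hp i
  have h : (fun q => expMul φ F q ^ 2) = fun q => Real.exp (2 * φ q) * F q ^ 2 := by
    funext q; rw [expMul, mul_pow, two_mul, Real.exp_add, pow_two]
  rw [h]
  simp only [delta, Fin.sum_univ_two, barthel]
  rw [baseD_mul d.exp dF, dotD_mul d.exp dF, dotD_mul d.exp dF, e]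
  ring

theorem delta_expMul_sq (hF : IsLocalRiemannian U F) (hφ : IsLocalFactor U F φ) (hp : p ∈ U)
    (i : Fin 2) : delta F i (fun q => expMul φ F q ^ 2) p
      = 2 * (expMul φ F p ^ 2 * delta F i φ p) := by
  have d := hφ.homog.differentiableAt hF.isOpen hp
  rw [← hφ.sq_mul_delta_exp hF hp]
  have e : Real.exp (2 * φ p) = Real.exp (φ p) ^ 2 := by rw [two_mul, Real.exp_add, pow_two]
  simp only [delta, Fin.sum_univ_two]
  rw [baseD_exp (d.const_mul 2), dotD_exp (d.const_mul 2), dotD_exp (d.const_mul 2),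
    baseD_const_mul d, dotD_const_mul d, dotD_const_mul d, expMul, e]
  ring

/-- This measures by how much the spray of `F` fails the linear system of `F̄`. Contracting `δ_i F̄²
= 2 F̄² δ_i φ` with `yⁱ` gives `yᵏ ∂_k F̄² = 2 Gʲ ∂F̄²/∂yʲ + 2 F̄² F φ_{,1}`. Differentiate it in
`yⁱ`, expand the derivative of the 3-homogeneous last term in the frame, and subtract `2 ∂_i F̄²`.
-/
theorem eulerLagrange_expMul (hF : IsLocalRiemannian U F) (hφ : IsLocalFactor U F φ) (hp : p ∈ U)
    (i : Fin 2) : eulerLagrange (expMul φ F) i p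
      = 4 * (metric (expMul φ F) p i 0 * spray F 0 p + metric (expMul φ F) p i 1 * spray F 1 p)
        + 2 * expMul φ F p ^ 2 * (h1 F φ p * ellLow F i p
          + (2 * v2 F φ p * h1 F φ p + v2 F (h1 F φ) p - 2 * h2 F φ p) * mLow F i p) := by
  have hU := hF.isOpen
  have hE := hφ.expMul_sq_homog hF
  have hE0 := hE.differentiableAt hU hp
  have d1 := (hφ.h1_homog hF).differentiableAt hU hp
  have dF := hF.homog.differentiableAt hU hp
  have db := fun k => (hE.baseD hU k).differentiableAt hU hp
  have dd := fun k => (hE.dotD hU k rfl).differentiableAt hU hp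
  have dG := fun k => (hF.homog_spray k).differentiableAt hU hp
  have dy := fun k => differentiableAt_snd_apply (p := p) k
  have hEF : IsHomog U 3 (fun q => expMul φ F q ^ 2 * F q) := hE.mul hF.homog hU (by norm_num)
  have hK : IsHomog U 3 (fun q => expMul φ F q ^ 2 * F q * h1 F φ q) :=
    hEF.mul (hφ.h1_homog hF) hU (by norm_num)
  have hK0 := hK.differentiableAt hU hp
  have s : ∀ q ∈ U, q.2 0 * baseD 0 (fun q => expMul φ F q ^ 2) q
      + q.2 1 * baseD 1 (fun q => expMul φ F q ^ 2) q
      = 2 * (spray F 0 q * dotD 0 (fun q => expMul φ F q ^ 2) q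
        + spray F 1 q * dotD 1 (fun q => expMul φ F q ^ 2) q)
        + 2 * (expMul φ F q ^ 2 * F q * h1 F φ q) := by
    intro q hq
    have a := hφ.delta_expMul_sq hF hq
    have g := fun j => (hF.homog_spray j).euler q hq
    have y := hF.mul_ellUp hq
    simp only [h1, Fin.sum_univ_two]
    have a0 := a 0
    have a1 := a 1
    have hd : ∀ i, delta F i (fun q => expMul φ F q ^ 2) q
      = baseD i (fun q => expMul φ F q ^ 2) q
        - (dotD i (spray F 0) q * dotD 0 (fun q => expMul φ F q ^ 2) q
          + dotD i (spray F 1) q * dotD 1 (fun q => expMul φ F q ^ 2) q) := fun i => by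
      simp [delta, barthel]
    rw [hd] at a0 a1
    linear_combination q.2 0 * a0 + q.2 1 * a1 + dotD 0 (fun q => expMul φ F q ^ 2) q * g 0
      + dotD 1 (fun q => expMul φ F q ^ 2) q * g 1
      - 2 * expMul φ F q ^ 2 * delta F 0 φ q * y 0 - 2 * expMul φ F q ^ 2 * delta F 1 φ q * y 1
  have s := dotD_congr hU s hp i
  rw [dotD_add ((dy 0).fun_mul (db 0)) ((dy 1).fun_mul (db 1)), dotD_mul (dy 0) (db 0),
    dotD_mul (dy 1) (db 1),
    dotD_add ((((dG 0).fun_mul (dd 0)).fun_add ((dG 1).fun_mul (dd 1))).const_mul 2)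
      (hK0.const_mul 2), dotD_const_mul hK0,
    dotD_const_mul (((dG 0).fun_mul (dd 0)).fun_add ((dG 1).fun_mul (dd 1))),
    dotD_add ((dG 0).fun_mul (dd 0)) ((dG 1).fun_mul (dd 1)),
    dotD_mul (dG 0) (dd 0), dotD_mul (dG 1) (dd 1), dotD_snd, dotD_snd] at s
  have k := hF.mul_dotD hK hp i
  rw [v2_mul (hEF.differentiableAt hU hp) d1, v2_mul hE0 dF, hφ.v2_expMul_sq hF hp,
    IsLocalMetric.v2_self] at k
  have k : dotD i (fun q => expMul φ F q ^ 2 * F q * h1 F φ q) p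
      = 3 * (expMul φ F p ^ 2 * h1 F φ p) * ellLow F i p
        + (2 * v2 F φ p * expMul φ F p ^ 2 * h1 F φ p + expMul φ F p ^ 2 * v2 F (h1 F φ) p)
          * mLow F i p := mul_left_cancel₀ (hF.ne_zero hp) (by linear_combination k)
  rw [k] at s
  have a := hφ.delta_expMul_sq hF hp i
  rw [delta_eq hF hp φ] at a
  have hd : delta F i (fun q => expMul φ F q ^ 2) p
      = baseD i (fun q => expMul φ F q ^ 2) p
        - (dotD i (spray F 0) p * dotD 0 (fun q => expMul φ F q ^ 2) p
          + dotD i (spray F 1) p * dotD 1 (fun q => expMul φ F q ^ 2) p) := by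
    simp [delta, barthel]
  rw [hd] at a
  simp only [eulerLagrange, Fin.sum_univ_two, metric, Matrix.of_apply,
    baseD_dotD_comm hU hE.smooth hp _ i]
  fin_cases i <;> simp at s a ⊢ <;> linear_combination s - 2 * a

/-- The sprays of `F̄ = e^φ F` and `F` differ by `P ℓⁱ + Q mⁱ`. -/
theorem spray_expMul (hF : IsLocalRiemannian U F) (hφ : IsLocalFactor U F φ) (hp : p ∈ U)
    (i : Fin 2) : spray (expMul φ F) i p = spray F i p + sprayDiff F φ i p := by
  refine (hφ.isLocalMetric_expMul hF).spray_eq_of_sum_metric hp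
    (w := fun i => spray F i p + sprayDiff F φ i p) (fun i => ?_) i
  rw [hφ.eulerLagrange_expMul hF hp]
  have hl := hF.ellLow_ellUp hp
  have hlm := IsLocalMetric.ellLow_mUp (F := F) (p := p)
  have hml := IsLocalMetric.mLow_ellUp (F := F) (p := p)
  have hmm := hF.mLow_mUp hp
  have ee := hF.eps_mul_eps hp
  have hr : rho F φ p * (sigma F φ p + eps F p - v2 F φ p ^ 2) = 1 :=
    one_div_mul_cancel (hφ.rho_denom_ne_zero hF hp)
  set W := v2 F φ p * h1 F φ p + v2 F (h1 F φ) p - 2 * h2 F φ p with hW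
  -- In the frame, the system for the difference of sprays has unknowns `P`, `εQ` and matrix rows
  -- `(1, φ_{;2})` and `(φ_{;2}, σ + ε)`. `hP` and `hQ` are its two equations, solved by Cramer's
  -- rule with `ρ` the inverse determinant.
  have hP : 2 * (P F φ p + eps F p * v2 F φ p * Q F φ p) = F p ^ 2 * h1 F φ p := by
    rw [P, Q]
    linear_combination v2 F φ p * rho F φ p * F p ^ 2 * W * ee
  have hQ : 2 * (v2 F φ p * P F φ p + eps F p * (sigma F φ p + eps F p) * Q F φ p)
      = F p ^ 2 * (W + v2 F φ p * h1 F φ p) := by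
    rw [P, Q]
    linear_combination F p ^ 2 * W * hr
      + (sigma F φ p + eps F p) * rho F φ p * F p ^ 2 * W * ee
  have hD : metric (expMul φ F) p i 0 * sprayDiff F φ 0 p
      + metric (expMul φ F) p i 1 * sprayDiff F φ 1 p
      = Real.exp (φ p) ^ 2 * ((P F φ p + eps F p * v2 F φ p * Q F φ p) * ellLow F i p
        + (v2 F φ p * P F φ p + eps F p * (sigma F φ p + eps F p) * Q F φ p) * mLow F i p) := by
    rw [hφ.metric_expMul hF hp, hφ.metric_expMul hF hp, sprayDiff, sprayDiff]
    linear_combination Real.exp (φ p) ^ 2 * (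
      (ellLow F i p + v2 F φ p * mLow F i p) * (P F φ p * hl + Q F φ p * hlm)
      + (v2 F φ p * ellLow F i p + (sigma F φ p + eps F p) * mLow F i p)
        * (P F φ p * hml + Q F φ p * hmm))
  rw [expMul]
  linear_combination hD + (1 / 2) * Real.exp (φ p) ^ 2 * (ellLow F i p * hP + mLow F i p * hQ)

end IsLocalFactor

/-! ### Berwald curvature and the tensor equation in coordinates -/

section

variable {U : Set (Plane × Plane)} {F φ : Plane × Plane → ℝ} {p : Plane × Plane}

/-- The spray coefficients of a pseudo-Riemannian metric are fibrewise quadratic. -/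
theorem IsLocalRiemannian.dotD_dotD_dotD_spray (hF : IsLocalRiemannian U F) (hp : p ∈ U)
    (h i j k : Fin 2) : dotD k (dotD i (dotD j (spray F h))) p = 0 := by
  have hU := hF.isOpen
  have hE := hF.homog_sq.smooth
  have sB : ∀ k i, ContDiffOn ℝ ∞ (dotD i (baseD k (fun q => F q ^ 2))) U := fun k i =>
    contDiffOn_dotD hU (contDiffOn_baseD hU hE k) i
  have dB : ∀ q ∈ U, ∀ k i, DifferentiableAt ℝ (dotD i (baseD k (fun q => F q ^ 2))) q :=
    fun q hq k i => differentiableAt_of_contDiffOn hU (sB k i) hq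
  have dB1 : ∀ q ∈ U, ∀ k i a,
      DifferentiableAt ℝ (dotD a (dotD i (baseD k (fun q => F q ^ 2)))) q :=
    fun q hq k i a => differentiableAt_of_contDiffOn hU (contDiffOn_dotD hU (sB k i) a) hq
  have dy := fun (q : Plane × Plane) k => differentiableAt_snd_apply (p := q) k
  -- Base and fibre derivatives commute, and the third fibre derivatives of `F²` vanish throughout
  -- `U`; hence so do those of `∂_k F²`.
  have hB : ∀ q ∈ U, ∀ k i a b,
      dotD b (dotD a (dotD i (baseD k (fun q => F q ^ 2)))) q = 0 := by
    intro q hq k i a b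
    have s1 := contDiffOn_dotD hU hE i
    have s2 := contDiffOn_dotD hU s1 a
    have e1 : ∀ r ∈ U, dotD i (baseD k (fun q => F q ^ 2)) r
      = baseD k (dotD i (fun q => F q ^ 2)) r := fun r hr => (baseD_dotD_comm hU hE hr k i).symm
    have e2 : ∀ r ∈ U, dotD a (dotD i (baseD k (fun q => F q ^ 2))) r
        = baseD k (dotD a (dotD i (fun q => F q ^ 2))) r := fun r hr => by
      rw [dotD_congr hU e1 hr, baseD_dotD_comm hU s1 hr]
    rw [dotD_congr hU e2 hq, ← baseD_dotD_comm hU s2 hq]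
    have e3 : ∀ r ∈ U, dotD b (dotD a (dotD i (fun q => F q ^ 2))) r = (fun _ => (0 : ℝ)) r := by
      intro r hr
      have := hF.dotD_metric r hr a i b
      simp only [metric, Matrix.of_apply] at this
      rw [dotD_const_mul (differentiableAt_of_contDiffOn hU s2 hr)] at this
      simpa using this
    rw [baseD_congr hU e3 hq]
    simp [baseD]
  -- Each fibre derivative of `yᵏ ∂_k ∂F²/∂yˡ` either hits the explicit `yᵏ` or raises the order on
  -- `F²`. After two of them no `y` is left, and the third kills what remains.
  have hA : ∀ l a b c, dotD c (dotD b (dotD a (eulerLagrange F l))) p = 0 := by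
    intro l a b c
    have e0 : ∀ q ∈ U, eulerLagrange F l q = q.2 0 * dotD l (baseD 0 (fun q => F q ^ 2)) q
        + q.2 1 * dotD l (baseD 1 (fun q => F q ^ 2)) q - baseD l (fun q => F q ^ 2) q :=
      fun q hq => by
        simp only [eulerLagrange, Fin.sum_univ_two, baseD_dotD_comm hU hE hq _ l]
    have e1 : ∀ q ∈ U, dotD a (eulerLagrange F l) q = dotD l (baseD a (fun q => F q ^ 2)) q
        + (q.2 0 * dotD a (dotD l (baseD 0 (fun q => F q ^ 2))) q
        + q.2 1 * dotD a (dotD l (baseD 1 (fun q => F q ^ 2))) q)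
        - dotD a (baseD l (fun q => F q ^ 2)) q := fun q hq => by
      have d := dB q hq
      have m := fun k => (dy q k).fun_mul (d k l)
      rw [dotD_congr hU e0 hq, dotD_sub ((m 0).fun_add (m 1))
        (differentiableAt_of_contDiffOn hU (contDiffOn_baseD hU hE l) hq), dotD_add (m 0) (m 1),
        dotD_mul (dy q 0) (d 0 l), dotD_mul (dy q 1) (d 1 l), dotD_snd, dotD_snd]
      fin_cases a <;> simp <;> ring
    have e2 : ∀ q ∈ U, dotD b (dotD a (eulerLagrange F l)) q
        = dotD b (dotD l (baseD a (fun q => F q ^ 2))) q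
        + dotD a (dotD l (baseD b (fun q => F q ^ 2))) q
        - dotD b (dotD a (baseD l (fun q => F q ^ 2))) q := fun q hq => by
      have d := dB1 q hq
      have m := fun k => (dy q k).fun_mul (d k l a)
      have z := hB q hq
      rw [dotD_congr hU e1 hq, dotD_sub ((dB q hq a l).fun_add ((m 0).fun_add (m 1)))
        (dB q hq l a), dotD_add (dB q hq a l) ((m 0).fun_add (m 1)), dotD_add (m 0) (m 1),
        dotD_mul (dy q 0) (d 0 l a), dotD_mul (dy q 1) (d 1 l a), dotD_snd, dotD_snd, z, z]
      fin_cases b <;> simp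
    rw [dotD_congr hU e2 hp, dotD_sub ((dB1 p hp a l b).fun_add (dB1 p hp b l a))
      (dB1 p hp l a b), dotD_add (dB1 p hp a l b) (dB1 p hp b l a), hB p hp, hB p hp, hB p hp]
    ring
  -- The metric tensor is constant on fibres, so fibre derivatives pass through the linear system.
  -- After three of them the right side is zero, and `g` is invertible.
  have step : ∀ {G₀ G₁ A : Plane × Plane → ℝ} (l a : Fin 2), ContDiffOn ℝ ∞ G₀ U →
      ContDiffOn ℝ ∞ G₁ U → ContDiffOn ℝ ∞ A U →
      (∀ q ∈ U, metric F q l 0 * G₀ q + metric F q l 1 * G₁ q = (1 / 4) * A q) →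
      ∀ q ∈ U, metric F q l 0 * dotD a G₀ q + metric F q l 1 * dotD a G₁ q
        = (1 / 4) * dotD a A q := by
    intro G₀ G₁ A l a s0 s1 sA e q hq
    have d0 := differentiableAt_of_contDiffOn hU s0 hq
    have d1 := differentiableAt_of_contDiffOn hU s1 hq
    have dA := differentiableAt_of_contDiffOn hU sA hq
    have dg := fun j => (hF.homog_metric l j).differentiableAt hU hq
    have := dotD_congr hU e hq a
    rw [dotD_add ((dg 0).fun_mul d0) ((dg 1).fun_mul d1), dotD_mul (dg 0) d0, dotD_mul (dg 1) d1,
      dotD_const_mul dA, hF.dotD_metric q hq, hF.dotD_metric q hq] at this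
    linear_combination this
  have sG := fun k => (hF.homog_spray k).smooth
  have sA := fun k => (hF.homog_eulerLagrange k).smooth
  have e : ∀ l, metric F p l 0 * dotD k (dotD i (dotD j (spray F 0))) p
      + metric F p l 1 * dotD k (dotD i (dotD j (spray F 1))) p = 0 := fun l => by
    have := step l k (contDiffOn_dotD hU (contDiffOn_dotD hU (sG 0) j) i)
      (contDiffOn_dotD hU (contDiffOn_dotD hU (sG 1) j) i)
      (contDiffOn_dotD hU (contDiffOn_dotD hU (sA l) j) i)
      (step l i (contDiffOn_dotD hU (sG 0) j) (contDiffOn_dotD hU (sG 1) j)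
        (contDiffOn_dotD hU (sA l) j)
        (step l j (sG 0) (sG 1) (sA l) fun q hq => hF.sum_metric_spray hq l)) p hp
    rw [this, hA, mul_zero]
  have hd := hF.det_ne_zero p hp
  rw [Matrix.det_fin_two] at hd
  have e0 := e 0
  have e1 := e 1
  fin_cases h
  · exact (mul_eq_zero.1 (show _ * dotD k (dotD i (dotD j (spray F 0))) p = 0 by
      linear_combination metric F p 1 1 * e0 - metric F p 0 1 * e1)).resolve_left hd
  · exact (mul_eq_zero.1 (show _ * dotD k (dotD i (dotD j (spray F 1))) p = 0 by
      linear_combination metric F p 0 0 * e1 - metric F p 1 0 * e0)).resolve_left hd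

namespace IsLocalFactor

theorem dotD_spray_expMul (hF : IsLocalRiemannian U F) (hφ : IsLocalFactor U F φ) (hp : p ∈ U)
    (h j : Fin 2) : dotD j (spray (expMul φ F) h) p
      = dotD j (spray F h) p + dotD j (sprayDiff F φ h) p := by
  rw [dotD_congr hF.isOpen (fun q hq => hφ.spray_expMul hF hq h) hp,
    dotD_add ((hF.homog_spray h).differentiableAt hF.isOpen hp)
      ((hφ.sprayDiff_homog hF h).differentiableAt hF.isOpen hp)]

theorem berwaldCurvature_expMul (hF : IsLocalRiemannian U F) (hφ : IsLocalFactor U F φ)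
    (hp : p ∈ U) (h i j k : Fin 2) : berwaldCurvature (expMul φ F) h i j k p
      = dotD k (dotD i (dotD j (sprayDiff F φ h))) p := by
  have hU := hF.isOpen
  have s1 := contDiffOn_dotD hU (hF.homog_spray h).smooth j
  have t1 := contDiffOn_dotD hU (hφ.sprayDiff_homog hF h).smooth j
  have e2 : ∀ q ∈ U, dotD i (dotD j (spray (expMul φ F) h)) q
      = dotD i (dotD j (spray F h)) q + dotD i (dotD j (sprayDiff F φ h)) q := fun q hq => by
    rw [dotD_congr hU (fun r hr => hφ.dotD_spray_expMul hF hr h j) hq,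
      dotD_add (differentiableAt_of_contDiffOn hU s1 hq) (differentiableAt_of_contDiffOn hU t1 hq)]
  rw [berwaldCurvature, berwaldConnection, barthel, dotD_congr hU e2 hp,
    dotD_add (differentiableAt_of_contDiffOn hU (contDiffOn_dotD hU s1 i) hp)
      (differentiableAt_of_contDiffOn hU (contDiffOn_dotD hU t1 i) hp),
    hF.dotD_dotD_dotD_spray hp, zero_add]

theorem dotD_Mexpr (hF : IsLocalRiemannian U F) (hφ : IsLocalFactor U F φ) (hp : p ∈ U)
    (i j k r : Fin 2) : dotD r (Mexpr F φ i j k) p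
      = dotD r (dotD k (dotD j (sprayDiff F φ i))) p :=
  dotD_congr hF.isOpen (fun _ hq => hφ.Mexpr_eq hF hq i j k) hp r

theorem contDiffOn_Mexpr (hF : IsLocalRiemannian U F) (hφ : IsLocalFactor U F φ)
    (i j k : Fin 2) : ContDiffOn ℝ ∞ (Mexpr F φ i j k) U :=
  (contDiffOn_dotD hF.isOpen (contDiffOn_dotD hF.isOpen (hφ.sprayDiff_homog hF i).smooth j)
    k).congr fun _ hq => hφ.Mexpr_eq hF hq i j k

theorem Mexpr_comm (hF : IsLocalRiemannian U F) (hφ : IsLocalFactor U F φ) (hp : p ∈ U)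
    (i j k : Fin 2) : Mexpr F φ i j k p = Mexpr F φ i k j p := by
  rw [hφ.Mexpr_eq hF hp, hφ.Mexpr_eq hF hp,
    dotD_comm hF.isOpen (hφ.sprayDiff_homog hF i).smooth hp]

/-- The connection of `F̄` annihilates `F̄²`, and it differs from that of `F` by the fibre
derivative of `sprayDiff`. -/
theorem delta_expMul_sq_eq (hF : IsLocalRiemannian U F) (hφ : IsLocalFactor U F φ) (hp : p ∈ U)
    (i : Fin 2) : delta F i (fun q => expMul φ F q ^ 2) p
      = dotD i (sprayDiff F φ 0) p * dotD 0 (fun q => expMul φ F q ^ 2) p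
        + dotD i (sprayDiff F φ 1) p * dotD 1 (fun q => expMul φ F q ^ 2) p := by
  have e := (hφ.isLocalMetric_expMul hF).delta_sq hp i
  rw [hφ.dotD_spray_expMul hF hp, hφ.dotD_spray_expMul hF hp] at e
  simp only [delta, Fin.sum_univ_two, barthel]
  linear_combination e

/-- A fibrewise constant tensor is given by `Mⁱ_jk` iff it satisfies Fuster's equation. -/
theorem eq_Mexpr_iff (hF : IsLocalRiemannian U F) (hφ : IsLocalFactor U F φ)
    {T : Fin 2 → Fin 2 → Fin 2 → Plane × Plane → ℝ} (hT : ∀ i j k, IsHomog U 0 (T i j k))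
    (hT0 : ∀ i j k r, ∀ q ∈ U, dotD r (T i j k) q = 0)
    (hs : ∀ i j k, ∀ q ∈ U, T i j k q = T i k j q) :
    (∀ q ∈ U, ∀ i j k, T i j k q = Mexpr F φ i j k q) ↔
    ∀ q ∈ U, ∀ i, F q ^ 2 * delta F i (fun z => Real.exp (2 * φ z)) q
      = ∑ k, ∑ j, q.2 k * T j i k q * dotD j (fun z => expMul φ F z ^ 2) q := by
  have hU := hF.isOpen
  constructor
  · intro h q hq i
    rw [hφ.sq_mul_delta_exp hF hq, hφ.delta_expMul_sq_eq hF hq]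
    -- Euler's identity for the 1-homogeneous functions `∂_i Dˡ`, whose fibre derivatives are the
    -- components of `M`.
    have e : ∀ l, q.2 0 * T l i 0 q + q.2 1 * T l i 1 q = dotD i (sprayDiff F φ l) q := by
      intro l
      rw [h q hq, h q hq, hφ.Mexpr_eq hF hq, hφ.Mexpr_eq hF hq]
      linear_combination ((hφ.sprayDiff_homog hF l).dotD hU i (t := 1) (by norm_num)).euler q hq
    simp only [← e, Fin.sum_univ_two]
    ring
  · intro h q hq i j k
    have hy := IsHomog.snd (U := U)
    have dy := fun (q : Plane × Plane) k => differentiableAt_snd_apply (p := q) k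
    let B : Fin 2 → Fin 2 → Plane × Plane → ℝ := fun i j q => q.2 0 * T i j 0 q + q.2 1 * T i j 1 q
    have hB : ∀ i j, IsHomog U 1 (B i j) := fun i j =>
      ((hy 0).mul (hT i j 0) hU (by norm_num)).add ((hy 1).mul (hT i j 1) hU (by norm_num)) hU
    have dB : ∀ i j k, ∀ q ∈ U, dotD k (B i j) q = T i j k q := by
      intro i j k q hq
      have dT := fun k => (hT i j k).differentiableAt hU hq
      simp only [B]
      rw [dotD_add ((dy q 0).fun_mul (dT 0)) ((dy q 1).fun_mul (dT 1)), dotD_mul (dy q 0) (dT 0),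
        dotD_mul (dy q 1) (dT 1), dotD_snd, dotD_snd, hT0 _ _ _ _ q hq, hT0 _ _ _ _ q hq]
      fin_cases k <;> simp
    -- The candidate `½ Tⁱ_jk yʲ yᵏ` for the difference of sprays. Its fibre gradient is `B`, by
    -- symmetry of `T` in the lower indices.
    let H : Fin 2 → Plane × Plane → ℝ := fun i q =>
      (1 / 2) * (q.2 0 * B i 0 q + q.2 1 * B i 1 q)
    have hH0 : ∀ i, IsHomog U 2 (fun q => q.2 0 * B i 0 q + q.2 1 * B i 1 q) := fun i =>
      ((hy 0).mul (hB i 0) hU (by norm_num)).add ((hy 1).mul (hB i 1) hU (by norm_num)) hU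
    have hH : ∀ i, IsHomog U 2 (H i) := fun i => (hH0 i).const_mul hU (1 / 2)
    have dH : ∀ i k, ∀ q ∈ U, dotD k (H i) q = B i k q := by
      intro i k q hq
      have d := fun k => (hB i k).differentiableAt hU hq
      have s := hs i 0 1 q hq
      simp only [H]
      rw [dotD_const_mul ((hH0 i).differentiableAt hU hq),
        dotD_add ((dy q 0).fun_mul (d 0)) ((dy q 1).fun_mul (d 1)), dotD_mul (dy q 0) (d 0),
        dotD_mul (dy q 1) (d 1), dotD_snd, dotD_snd, dB i 0 k q hq, dB i 1 k q hq]
      simp only [B]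
      fin_cases k <;> simp <;> rw [s] <;> ring
    have hspray : ∀ q ∈ U, ∀ i, sprayDiff F φ i q = H i q := by
      intro q hq i
      have := (hφ.isLocalMetric_expMul hF).spray_eq_of_delta_sq
        (G := fun i q => spray F i q + H i q) (fun i => (hF.homog_spray i).add (hH i) hU)
        (fun r hr i => by
          have e := h r hr i
          rw [hφ.sq_mul_delta_exp hF hr] at e
          have dG := fun k => (hF.homog_spray k).differentiableAt hU hr
          have dh := fun k => (hH k).differentiableAt hU hr
          rw [dotD_add (dG 0) (dh 0), dotD_add (dG 1) (dh 1), dH _ _ r hr, dH _ _ r hr]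
          simp only [delta, Fin.sum_univ_two, barthel] at e
          simp only [B]
          linear_combination e) hq i
      rw [hφ.spray_expMul hF hq] at this
      linear_combination this
    rw [hφ.Mexpr_eq hF hq, dotD_congr hU (fun r hr => (dotD_congr hU
      (fun z hz => hspray z hz i) hr j).trans (dH i j r hr)) hq, dB i j k q hq]

end IsLocalFactor

end

/-! ### Changes of coordinates -/

section

variable {h : Plane × Plane → ℝ} {p : Plane × Plane}

theorem plane_eq_sum (v : Plane) :
    v = v 0 • EuclideanSpace.single 0 (1 : ℝ) + v 1 • EuclideanSpace.single 1 (1 : ℝ) := by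
  ext i
  fin_cases i <;> simp

theorem fderiv_apply_eq (u w : Plane) : fderiv ℝ h p (u, w)
    = (u 0 * baseD 0 h p + u 1 * baseD 1 h p) + (w 0 * dotD 0 h p + w 1 * dotD 1 h p) := by
  have : (u, w) = (u 0 • (EuclideanSpace.single 0 (1 : ℝ), (0 : Plane))
      + u 1 • (EuclideanSpace.single 1 (1 : ℝ), (0 : Plane)))
      + (w 0 • ((0 : Plane), EuclideanSpace.single 0 (1 : ℝ))
      + w 1 • ((0 : Plane), EuclideanSpace.single 1 (1 : ℝ))) := by
    ext i <;> fin_cases i <;> simp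
  rw [this]
  simp only [map_add, map_smul, smul_eq_mul, baseD, dotD]

/-- The map of the tangent bundle of the plane induced by `ψ`. -/
def tangentLift (ψ : Plane → Plane) (q : Plane × Plane) : Plane × Plane :=
  (ψ q.1, fderiv ℝ ψ q.1 q.2)

/-- The entries of the Jacobian matrix of `ψ`. -/
def jacobian (ψ : Plane → Plane) (i j : Fin 2) (q : Plane × Plane) : ℝ :=
  fderiv ℝ ψ q.1 (EuclideanSpace.single j (1 : ℝ)) i

theorem fderiv_apply_apply (ψ : Plane → Plane) (q : Plane × Plane) (v : Plane) (i : Fin 2) :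
    fderiv ℝ ψ q.1 v i = jacobian ψ i 0 q * v 0 + jacobian ψ i 1 q * v 1 := by
  conv_lhs => rw [plane_eq_sum v]
  simp [jacobian]
  ring

end

/-- `ψ` is a smooth change of base coordinates whose tangent lift maps `U` to `U'`. -/
structure IsCoordChange (U U' : Set (Plane × Plane)) (ψ : Plane → Plane) : Prop where
  isOpen : IsOpen U
  isOpen' : IsOpen U'
  smooth : ContDiffOn ℝ ∞ ψ (Prod.fst '' U)
  mapsTo : ∀ q ∈ U, tangentLift ψ q ∈ U'
  surjective : ∀ q ∈ U, Function.Surjective (fderiv ℝ ψ q.1)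

namespace IsCoordChange

variable {U U' : Set (Plane × Plane)} {ψ : Plane → Plane} {h : Plane × Plane → ℝ}
  {q : Plane × Plane}

theorem contDiffAt (hψ : IsCoordChange U U' ψ) (hq : q ∈ U) : ContDiffAt ℝ ∞ ψ q.1 :=
  hψ.smooth.contDiffAt ((isOpenMap_fst _ hψ.isOpen).mem_nhds ⟨q, hq, rfl⟩)

theorem contDiffAt_fderiv (hψ : IsCoordChange U U' ψ) (hq : q ∈ U) :
    ContDiffAt ℝ ∞ (fun r : Plane × Plane => fderiv ℝ ψ r.1) q :=
  ((hψ.contDiffAt hq).fderiv_right (m := ∞) (by simp)).comp q contDiffAt_fst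

theorem contDiffOn_jacobian (hψ : IsCoordChange U U' ψ) (i j : Fin 2) :
    ContDiffOn ℝ ∞ (jacobian ψ i j) U := fun _ hq =>
  ((EuclideanSpace.proj i : Plane →L[ℝ] ℝ).contDiff.contDiffAt.comp _
    ((hψ.contDiffAt_fderiv hq).clm_apply contDiffAt_const)).contDiffWithinAt

theorem dotD_jacobian (hψ : IsCoordChange U U' ψ) (hq : q ∈ U) (i j k : Fin 2) :
    dotD k (jacobian ψ i j) q = 0 :=
  dotD_eq_zero_of_forall_fst_eq hψ.isOpen
    (differentiableAt_of_contDiffOn hψ.isOpen (hψ.contDiffOn_jacobian i j) hq) hq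
    (fun r _ hr => by simp only [jacobian, hr]) k

theorem hasFDerivAt_tangentLift (hψ : IsCoordChange U U' ψ) (hq : q ∈ U) :
    HasFDerivAt (tangentLift ψ)
      (((fderiv ℝ ψ q.1).comp (ContinuousLinearMap.fst ℝ Plane Plane)).prod
      ((fderiv ℝ ψ q.1).comp (ContinuousLinearMap.snd ℝ Plane Plane)
        + (((fderiv ℝ (fderiv ℝ ψ) q.1).comp
          (ContinuousLinearMap.fst ℝ Plane Plane)).flip q.2))) q := by
  have h1 : HasFDerivAt ψ (fderiv ℝ ψ q.1) q.1 :=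
    ((hψ.contDiffAt hq).differentiableAt (by simp)).hasFDerivAt
  have h2 : HasFDerivAt (fderiv ℝ ψ) (fderiv ℝ (fderiv ℝ ψ) q.1) q.1 :=
    (((hψ.contDiffAt hq).fderiv_right (m := ∞) (by simp)).differentiableAt (by simp)).hasFDerivAt
  have h3 := h1.comp q hasFDerivAt_fst
  have h4 := h2.comp q hasFDerivAt_fst
  exact h3.prodMk (h4.clm_apply hasFDerivAt_snd)

theorem fderiv_comp_apply (hψ : IsCoordChange U U' ψ) (hh : ContDiffOn ℝ ∞ h U') (hq : q ∈ U)
    (u w : Plane) : fderiv ℝ (fun r => h (tangentLift ψ r)) q (u, w)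
      = fderiv ℝ h (tangentLift ψ q) (fderiv ℝ ψ q.1 u,
        fderiv ℝ ψ q.1 w + fderiv ℝ (fderiv ℝ ψ) q.1 u q.2) := by
  have d := (differentiableAt_of_contDiffOn hψ.isOpen' hh (hψ.mapsTo q hq)).hasFDerivAt
  have := (d.comp q (hψ.hasFDerivAt_tangentLift hq)).fderiv
  rw [show (fun r => h (tangentLift ψ r)) = h ∘ tangentLift ψ from rfl, this]
  rfl

theorem dotD_comp (hψ : IsCoordChange U U' ψ) (hh : ContDiffOn ℝ ∞ h U') (hq : q ∈ U)
    (j : Fin 2) : dotD j (fun r => h (tangentLift ψ r)) q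
      = jacobian ψ 0 j q * dotD 0 h (tangentLift ψ q)
        + jacobian ψ 1 j q * dotD 1 h (tangentLift ψ q) := by
  rw [dotD, hψ.fderiv_comp_apply hh hq, fderiv_apply_eq]
  simp [jacobian]

theorem contDiffOn_comp (hψ : IsCoordChange U U' ψ) (hh : ContDiffOn ℝ ∞ h U') :
    ContDiffOn ℝ ∞ (fun r => h (tangentLift ψ r)) U := fun q hq =>
  ((hh.contDiffAt (hψ.isOpen'.mem_nhds (hψ.mapsTo q hq))).comp q
    (((hψ.contDiffAt hq).comp q contDiffAt_fst).prodMk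
      ((hψ.contDiffAt_fderiv hq).clm_apply contDiffAt_snd))).contDiffWithinAt

/-- The spray coefficients as a vector. -/
def sprayVec (F : Plane × Plane → ℝ) (q : Plane × Plane) : Plane :=
  WithLp.toLp 2 fun i => spray F i q

/-- A form of the Euler–Lagrange system free of indices: along the field `(y, -2w)`, the fibre
derivative of `F²` in direction `v` changes at the rate of the base derivative in direction `v`, for
every `v`, exactly when `w` solves the system. In this form it can be pulled back by a tangent lift.
-/
theorem fderiv_fderiv_sq (hU : IsOpen U) {F : Plane × Plane → ℝ} (hF : IsLocalMetric U F)
    (hq : q ∈ U) (v w : Plane) :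
    fderiv ℝ (fun r => fderiv ℝ (fun z => F z ^ 2) r (0, v)) q (q.2, (-2 : ℝ) • w)
      - fderiv ℝ (fun z => F z ^ 2) q (v, 0)
      = v 0 * (eulerLagrange F 0 q - 4 * (metric F q 0 0 * w 0 + metric F q 0 1 * w 1))
        + v 1 * (eulerLagrange F 1 q - 4 * (metric F q 1 0 * w 0 + metric F q 1 1 * w 1)) := by
  have hE := hF.homog_sq.smooth
  have dd := fun i => differentiableAt_of_contDiffOn hU (contDiffOn_dotD hU hE i) hq
  have e : (fun r => fderiv ℝ (fun z => F z ^ 2) r (0, v)) = fun r =>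
      v 0 * dotD 0 (fun z => F z ^ 2) r + v 1 * dotD 1 (fun z => F z ^ 2) r := by
    funext r; rw [fderiv_apply_eq]; simp
  rw [e, fderiv_fun_add ((dd 0).const_mul _) ((dd 1).const_mul _), fderiv_const_mul (dd 0),
    fderiv_const_mul (dd 1), add_apply, smul_apply, smul_apply, fderiv_apply_eq, fderiv_apply_eq,
    fderiv_apply_eq]
  simp only [eulerLagrange, Fin.sum_univ_two, metric, Matrix.of_apply]
  rw [dotD_comm hU hE hq 0 1]
  simp
  ring

/-- The transformation law of spray coefficients under a change of coordinates. -/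
theorem sprayVec_tangentLift (hψ : IsCoordChange U U' ψ) {F F' : Plane × Plane → ℝ}
    (hF : IsLocalMetric U F) (hF' : IsLocalMetric U' F')
    (hFF : ∀ r ∈ U, F r = F' (tangentLift ψ r)) (hq : q ∈ U) :
    sprayVec F' (tangentLift ψ q) = fderiv ℝ ψ q.1 (sprayVec F q)
      - (1 / 2 : ℝ) • fderiv ℝ (fderiv ℝ ψ) q.1 q.2 q.2 := by
  have hU := hψ.isOpen
  have hU' := hψ.isOpen'
  set w := fderiv ℝ ψ q.1 (sprayVec F q)
      - (1 / 2 : ℝ) • fderiv ℝ (fderiv ℝ ψ) q.1 q.2 q.2 with hw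
  have hE' := hF'.homog_sq.smooth
  have e1 : ∀ r ∈ U, ∀ a b : Plane, fderiv ℝ (fun z => F z ^ 2) r (a, b)
      = fderiv ℝ (fun z => F' z ^ 2) (tangentLift ψ r) (fderiv ℝ ψ r.1 a,
        fderiv ℝ ψ r.1 b + fderiv ℝ (fderiv ℝ ψ) r.1 a r.2) := fun r hr a b => by
    rw [fderiv_congr_of_isOpen hU (k := fun z => F' (tangentLift ψ z) ^ 2)
      (fun z hz => by rw [hFF z hz]) hr]
    exact hψ.fderiv_comp_apply (h := fun z => F' z ^ 2) hE' hr a b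
  have key : ∀ v : Plane, fderiv ℝ (fun r => fderiv ℝ (fun z => F' z ^ 2) r (0, v))
      (tangentLift ψ q) ((tangentLift ψ q).2, (-2 : ℝ) • w)
      - fderiv ℝ (fun z => F' z ^ 2) (tangentLift ψ q) (v, 0) = 0 := by
    intro v
    obtain ⟨v, rfl⟩ := hψ.surjective q hq v
    have e := fderiv_fderiv_sq hU hF hq v (sprayVec F q)
    have s := hF.sum_metric_spray hq
    have hz : ∀ i, eulerLagrange F i q - 4 * (metric F q i 0 * sprayVec F q 0
        + metric F q i 1 * sprayVec F q 1) = 0 := fun i => by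
      simp only [sprayVec]; linear_combination -4 * s i
    rw [hz, hz, mul_zero, mul_zero, add_zero, sub_eq_zero] at e
    have dc : ∀ a, ContDiffAt ℝ ∞ (fun r : Plane × Plane => fderiv ℝ ψ r.1 v a) q := fun a =>
      (EuclideanSpace.proj a : Plane →L[ℝ] ℝ).contDiff.contDiffAt.comp q
        ((hψ.contDiffAt_fderiv hq).clm_apply contDiffAt_const)
    have fc : ∀ a (u z : Plane), fderiv ℝ (fun r : Plane × Plane => fderiv ℝ ψ r.1 v a) q (u, z)
        = fderiv ℝ (fderiv ℝ ψ) q.1 u v a := by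
      intro a u z
      have h2 : HasFDerivAt (fderiv ℝ ψ) (fderiv ℝ (fderiv ℝ ψ) q.1) q.1 :=
        (((hψ.contDiffAt hq).fderiv_right (m := ∞) (by simp)).differentiableAt
          (by simp)).hasFDerivAt
      have h3 := (EuclideanSpace.proj a : Plane →L[ℝ] ℝ).hasFDerivAt.comp q
        ((h2.comp q hasFDerivAt_fst).clm_apply (hasFDerivAt_const v q))
      have h4 : fderiv ℝ (fun r : Plane × Plane => fderiv ℝ ψ r.1 v a) q = _ := h3.fderiv
      rw [h4]
      simp
    have sD := fun a => contDiffOn_dotD hU' hE' a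
    have dD := fun a => differentiableAt_of_contDiffOn hU (hψ.contDiffOn_comp (sD a)) hq
    have e2 : ∀ r ∈ U, fderiv ℝ (fun z => F z ^ 2) r (0, v)
        = fderiv ℝ ψ r.1 v 0 * dotD 0 (fun z => F' z ^ 2) (tangentLift ψ r)
        + fderiv ℝ ψ r.1 v 1 * dotD 1 (fun z => F' z ^ 2) (tangentLift ψ r) := fun r hr => by
      rw [e1 r hr, fderiv_apply_eq]; simp
    have dc' := fun a => (dc a).differentiableAt (by simp)
    rw [fderiv_congr_of_isOpen hU e2 hq, fderiv_fun_add ((dc' 0).fun_mul (dD 0))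
      ((dc' 1).fun_mul (dD 1)), fderiv_fun_mul (dc' 0) (dD 0), fderiv_fun_mul (dc' 1) (dD 1),
      e1 q hq] at e
    simp only [add_apply, smul_apply, smul_eq_mul, fc, hψ.fderiv_comp_apply (sD _) hq] at e
    -- Two correction terms appear: `D²ψ(y, v)`, from differentiating the coefficient `Dψ v`, and
    -- `D²ψ(v, y)`, from the base derivative of the lift. They cancel by symmetry.
    have hsymm : fderiv ℝ (fderiv ℝ ψ) q.1 v q.2 = fderiv ℝ (fderiv ℝ ψ) q.1 q.2 v :=
      ((hψ.contDiffAt hq).isSymmSndFDerivAt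
        (by simpa using WithTop.coe_le_coe.2 (le_top (a := (2 : ℕ∞))))).eq _ _
    rw [hsymm] at e
    have hdir : fderiv ℝ ψ q.1 ((-2 : ℝ) • sprayVec F q) + fderiv ℝ (fderiv ℝ ψ) q.1 q.2 q.2
        = (-2 : ℝ) • w := by
      rw [hw, map_smul]; module
    rw [hdir] at e
    have e3 : (fun r => fderiv ℝ (fun z => F' z ^ 2) r (0, fderiv ℝ ψ q.1 v)) = fun r =>
        fderiv ℝ ψ q.1 v 0 * dotD 0 (fun z => F' z ^ 2) r
          + fderiv ℝ ψ q.1 v 1 * dotD 1 (fun z => F' z ^ 2) r := by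
      funext r; rw [fderiv_apply_eq]; simp
    have dD' := fun a => differentiableAt_of_contDiffOn hU' (sD a) (hψ.mapsTo q hq)
    rw [e3, fderiv_fun_add ((dD' 0).const_mul _) ((dD' 1).const_mul _), fderiv_const_mul (dD' 0),
      fderiv_const_mul (dD' 1), add_apply, smul_apply, smul_apply]
    rw [fderiv_apply_eq (h := fun z => F' z ^ 2)] at e ⊢
    simp only [map_zero, zero_add, smul_eq_mul, PiLp.zero_apply, zero_mul, add_zero] at e ⊢
    change _ * (fderiv ℝ (dotD 0 fun z => F' z ^ 2) (tangentLift ψ q))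
      (fderiv ℝ ψ q.1 q.2, (-2 : ℝ) • w) + _ * (fderiv ℝ (dotD 1 fun z => F' z ^ 2)
      (tangentLift ψ q)) (fderiv ℝ ψ q.1 q.2, (-2 : ℝ) • w) - _ = 0
    linear_combination e
  have hq' := hψ.mapsTo q hq
  have hs := hF'.spray_eq_of_sum_metric hq' (w := fun i => w i) (fun i => by
    have e := fderiv_fderiv_sq hU' hF' hq' (EuclideanSpace.single i (1 : ℝ)) w
    rw [key] at e
    fin_cases i <;> simp at e ⊢ <;> linear_combination (1 / 4) * e)
  ext i
  exact hs i

/-- The difference of two sprays, and hence its fibrewise Hessian, is a tensor. -/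
theorem hessian_tangentLift (hψ : IsCoordChange U U' ψ) {F F' φ φ' : Plane × Plane → ℝ}
    (hF : IsLocalRiemannian U F) (hF' : IsLocalRiemannian U' F')
    (hφ : IsLocalFactor U F φ) (hφ' : IsLocalFactor U' F' φ')
    (hFF : ∀ r ∈ U, F r = F' (tangentLift ψ r)) (hφφ : ∀ r ∈ U, φ r = φ' (tangentLift ψ r))
    (hq : q ∈ U) (i j k : Fin 2) :
    ∑ a, ∑ b, Mexpr F' φ' i a b (tangentLift ψ q) * jacobian ψ a j q * jacobian ψ b k q
      = ∑ l, jacobian ψ i l q * Mexpr F φ l j k q := by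
  have hU := hψ.isOpen
  have hU' := hψ.isOpen'
  -- The term `½ D²ψ(y, y)` is the same for both metrics and drops out of the difference. The
  -- Jacobian entries depend on `x` only, so two fibre derivatives of this vector law give the
  -- tensor law.
  have e0 : ∀ r ∈ U, sprayDiff F' φ' i (tangentLift ψ r)
      = jacobian ψ i 0 r * sprayDiff F φ 0 r + jacobian ψ i 1 r * sprayDiff F φ 1 r := by
    intro r hr
    have h1 := congrArg (fun v : Plane => v i) (hψ.sprayVec_tangentLift hF.toIsLocalMetric
      hF'.toIsLocalMetric hFF hr)
    have h2 := congrArg (fun v : Plane => v i) (hψ.sprayVec_tangentLift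
      (hφ.isLocalMetric_expMul hF) (hφ'.isLocalMetric_expMul hF')
      (fun r hr => by rw [expMul, expMul, hFF r hr, hφφ r hr]) hr)
    simp only [PiLp.sub_apply, fderiv_apply_apply] at h1 h2
    simp only [sprayVec, hφ.spray_expMul hF hr, hφ'.spray_expMul hF' (hψ.mapsTo r hr)] at h1 h2
    linear_combination h2 - h1
  have sJ := fun j => hψ.contDiffOn_jacobian i j
  have sD := fun l => (hφ.sprayDiff_homog hF l).smooth
  have sD' := (hφ'.sprayDiff_homog hF' i).smooth
  have step : ∀ {A B : Plane × Plane → ℝ}, ContDiffOn ℝ ∞ A U → ContDiffOn ℝ ∞ B U → ∀ m,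
      ∀ r ∈ U, dotD m (fun z => jacobian ψ i 0 z * A z + jacobian ψ i 1 z * B z) r
        = jacobian ψ i 0 r * dotD m A r + jacobian ψ i 1 r * dotD m B r := by
    intro A B sA sB m r hr
    have dA := differentiableAt_of_contDiffOn hU sA hr
    have dB := differentiableAt_of_contDiffOn hU sB hr
    have dJ := fun j => differentiableAt_of_contDiffOn hU (sJ j) hr
    rw [dotD_add ((dJ 0).fun_mul dA) ((dJ 1).fun_mul dB), dotD_mul (dJ 0) dA, dotD_mul (dJ 1) dB,
      hψ.dotD_jacobian hr, hψ.dotD_jacobian hr]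
    ring
  have e1 : ∀ r ∈ U, jacobian ψ 0 j r * dotD 0 (sprayDiff F' φ' i) (tangentLift ψ r)
      + jacobian ψ 1 j r * dotD 1 (sprayDiff F' φ' i) (tangentLift ψ r)
      = jacobian ψ i 0 r * dotD j (sprayDiff F φ 0) r
        + jacobian ψ i 1 r * dotD j (sprayDiff F φ 1) r := fun r hr => by
    rw [← hψ.dotD_comp sD' hr, dotD_congr hU e0 hr, step (sD 0) (sD 1) j r hr]
  have e2 := dotD_congr hU e1 hq k
  have sD1 := fun a => contDiffOn_dotD hU' sD' a
  have dD1 := fun a => differentiableAt_of_contDiffOn hU (hψ.contDiffOn_comp (sD1 a)) hq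
  have dJ := fun a => differentiableAt_of_contDiffOn hU (hψ.contDiffOn_jacobian a j) hq
  rw [step (contDiffOn_dotD hU (sD 0) j) (contDiffOn_dotD hU (sD 1) j) k q hq,
    dotD_add ((dJ 0).fun_mul (dD1 0)) ((dJ 1).fun_mul (dD1 1)), dotD_mul (dJ 0) (dD1 0),
    dotD_mul (dJ 1) (dD1 1), hψ.dotD_jacobian hq, hψ.dotD_jacobian hq, hψ.dotD_comp (sD1 0) hq,
    hψ.dotD_comp (sD1 1) hq] at e2
  simp only [Fin.sum_univ_two, hφ.Mexpr_eq hF hq, hφ'.Mexpr_eq hF' (hψ.mapsTo q hq)]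
  linear_combination e2

end IsCoordChange

/-! ### Charts -/

section Manifold

variable {M : Type*} [TopologicalSpace M] [ChartedSpace Plane M]

theorem tangentBundle_ext {x x' : M} {v v' : Plane} (hx : x = x') (hv : v = v') :
    (⟨x, v⟩ : TangentBundle 𝓘(ℝ, Plane) M) = ⟨x', v'⟩ := by
  subst hx; subst hv; rfl

variable {e e' : OpenPartialHomeomorph M Plane} {A : Set (TangentBundle 𝓘(ℝ, Plane) M)}
  {F φ f : TangentBundle 𝓘(ℝ, Plane) M → ℝ} {q : Plane × Plane} {x : M}

/-- The derivative of a chart. -/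
def chartDeriv (e : OpenPartialHomeomorph M Plane) (x : M) : Plane →L[ℝ] Plane :=
  mfderiv 𝓘(ℝ, Plane) 𝓘(ℝ, Plane) e x

/-- The derivative of the inverse of a chart. -/
def chartSymmDeriv (e : OpenPartialHomeomorph M Plane) (x : Plane) : Plane →L[ℝ] Plane :=
  mfderiv 𝓘(ℝ, Plane) 𝓘(ℝ, Plane) e.symm x

theorem chart_mdifferentiable (he : e ∈ IsManifold.maximalAtlas 𝓘(ℝ, Plane) ∞ M) :
    e.MDifferentiable 𝓘(ℝ, Plane) 𝓘(ℝ, Plane) :=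
  ⟨(contMDiffOn_of_mem_maximalAtlas he).mdifferentiableOn (by simp),
    (contMDiffOn_symm_of_mem_maximalAtlas he).mdifferentiableOn (by simp)⟩

theorem chartDeriv_chartSymmDeriv (he : e ∈ IsManifold.maximalAtlas 𝓘(ℝ, Plane) ∞ M) {x : Plane}
    (hx : x ∈ e.target) (v : Plane) : chartDeriv e (e.symm x) (chartSymmDeriv e x v) = v :=
  congrArg (fun L : Plane →L[ℝ] Plane => L v) ((chart_mdifferentiable he).comp_symm_deriv hx)

theorem chartSymmDeriv_chartDeriv (he : e ∈ IsManifold.maximalAtlas 𝓘(ℝ, Plane) ∞ M)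
    (hx : x ∈ e.source) (v : Plane) : chartSymmDeriv e (e x) (chartDeriv e x v) = v :=
  congrArg (fun L : Plane →L[ℝ] Plane => L v) ((chart_mdifferentiable he).symm_comp_deriv hx)

theorem chartVector_smul (t : ℝ) (q : Plane × Plane) : chartVector e (q.1, t • q.2)
    = ⟨(chartVector e q).1, t • (chartVector e q).2⟩ :=
  tangentBundle_ext rfl (map_smul (chartSymmDeriv e q.1) t q.2)

/-- The transition map between two charts. -/
def transition (e e' : OpenPartialHomeomorph M Plane) : Plane → Plane := e' ∘ e.symm

theorem contDiffAt_transition (he : e ∈ IsManifold.maximalAtlas 𝓘(ℝ, Plane) ∞ M)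
    (he' : e' ∈ IsManifold.maximalAtlas 𝓘(ℝ, Plane) ∞ M) {x : Plane} (hx : x ∈ e.target)
    (hx' : e.symm x ∈ e'.source) : ContDiffAt ℝ ∞ (transition e e') x := by
  rw [← contMDiffAt_iff_contDiffAt]
  exact (contMDiffAt_of_mem_maximalAtlas he' hx').comp x
    (contMDiffAt_symm_of_mem_maximalAtlas he hx)

theorem fderiv_transition (he : e ∈ IsManifold.maximalAtlas 𝓘(ℝ, Plane) ∞ M)
    (he' : e' ∈ IsManifold.maximalAtlas 𝓘(ℝ, Plane) ∞ M) {x : Plane} (hx : x ∈ e.target)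
    (hx' : e.symm x ∈ e'.source) (v : Plane) : fderiv ℝ (transition e e') x v
      = chartDeriv e' (e.symm x) (chartSymmDeriv e x v) := by
  have h1 := (chart_mdifferentiable he').1.mdifferentiableAt (e'.open_source.mem_nhds hx')
  have h2 := (chart_mdifferentiable he).2.mdifferentiableAt (e.open_target.mem_nhds hx)
  rw [← mfderiv_eq_fderiv]
  exact congrArg (fun L : Plane →L[ℝ] Plane => L v) (mfderiv_comp x h1 h2)

theorem chartVector_tangentLift (he : e ∈ IsManifold.maximalAtlas 𝓘(ℝ, Plane) ∞ M)
    (he' : e' ∈ IsManifold.maximalAtlas 𝓘(ℝ, Plane) ∞ M) (hx : q.1 ∈ e.target)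
    (hx' : e.symm q.1 ∈ e'.source) :
    chartVector e' (tangentLift (transition e e') q) = chartVector e q := by
  refine tangentBundle_ext (e'.left_inv hx') ?_
  change chartSymmDeriv e' (e' (e.symm q.1)) (fderiv ℝ (transition e e') q.1 q.2)
    = chartSymmDeriv e q.1 q.2
  rw [fderiv_transition he he' hx hx', chartSymmDeriv_chartDeriv he' hx']

variable [IsManifold 𝓘(ℝ, Plane) ∞ M]

/-- In the product coordinates of the tangent bundle of the plane, `chartVector` is the tangent map
of the inverse chart, hence smooth. -/
theorem contMDiffOn_chartVector (he : e ∈ IsManifold.maximalAtlas 𝓘(ℝ, Plane) ∞ M) :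
    ContMDiffOn 𝓘(ℝ, Plane × Plane) 𝓘(ℝ, Plane).tangent ∞ (chartVector e)
      (e.target ×ˢ Set.univ) := by
  have h1 := (contMDiffOn_symm_of_mem_maximalAtlas he).contMDiffOn_tangentMapWithin (m := ∞)
    (by simp) e.open_target.uniqueMDiffOn
  have h2 : ContMDiff 𝓘(ℝ, Plane × Plane) 𝓘(ℝ, Plane).tangent ∞
      (fun q : Plane × Plane => (⟨q.1, q.2⟩ : TangentBundle 𝓘(ℝ, Plane) Plane)) := by
    have := contMDiff_tangentBundleModelSpaceHomeomorph_symm (I := 𝓘(ℝ, Plane)) (n := ∞)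
    rw [modelWithCornersSelf_prod]
    exact this
  refine (h1.comp h2.contMDiffOn (fun q hq => hq.1)).congr fun q hq => ?_
  exact (tangentMapWithin_eq_tangentMap (p := ⟨q.1, q.2⟩)
    (e.open_target.uniqueMDiffWithinAt hq.1)
    ((chart_mdifferentiable he).2.mdifferentiableAt (e.open_target.mem_nhds hq.1))).symm

theorem isOpen_chartDomain (he : e ∈ IsManifold.maximalAtlas 𝓘(ℝ, Plane) ∞ M) (hA : IsOpen A) :
    IsOpen (chartDomain e A) := by
  have := (contMDiffOn_chartVector he).continuousOn.isOpen_inter_preimage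
    (e.open_target.prod isOpen_univ) hA
  convert this using 1
  ext q
  simp [chartDomain]

theorem contDiffOn_chartRep (he : e ∈ IsManifold.maximalAtlas 𝓘(ℝ, Plane) ∞ M)
    (hf : ContMDiffOn 𝓘(ℝ, Plane).tangent 𝓘(ℝ, ℝ) ∞ f A) :
    ContDiffOn ℝ ∞ (chartRep e f) (chartDomain e A) := by
  rw [← contMDiffOn_iff_contDiffOn]
  exact hf.comp ((contMDiffOn_chartVector he).mono fun q hq => ⟨hq.1, trivial⟩) fun q hq => hq.2

theorem chartRep_homog (hA : IsConicSubbundle A)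
    (he : e ∈ IsManifold.maximalAtlas 𝓘(ℝ, Plane) ∞ M)
    (hf : ContMDiffOn 𝓘(ℝ, Plane).tangent 𝓘(ℝ, ℝ) ∞ f A) (r : ℕ)
    (hr : ∀ p ∈ A, ∀ t : ℝ, 0 < t → f ⟨p.1, t • p.2⟩ = t ^ r * f p) :
    IsHomog (chartDomain e A) r (chartRep e f) where
  smooth := contDiffOn_chartRep he hf
  euler p hp := by
    have d := (differentiableAt_of_contDiffOn (isOpen_chartDomain he hA.isOpen)
      (contDiffOn_chartRep he hf) hp).hasFDerivAt
    -- Euler's identity is the derivative at `t = 1` of the scaling law along the ray `t ↦ (x, t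
    -- y)`.
    have hl : HasDerivAt (fun t : ℝ => (p.1, t • p.2)) ((0 : Plane), p.2) 1 :=
      (hasDerivAt_const 1 p.1).prodMk (by simpa using (hasDerivAt_id (1 : ℝ)).smul_const p.2)
    have d' : HasFDerivAt (chartRep e f) (fderiv ℝ (chartRep e f) p)
        ((fun t : ℝ => (p.1, t • p.2)) 1) := by simpa using d
    have h1 : HasDerivAt (fun t : ℝ => chartRep e f (p.1, t • p.2))
        (fderiv ℝ (chartRep e f) p (0, p.2)) 1 := (d'.comp_hasDerivAt (1 : ℝ) hl :)
    have h2 : HasDerivAt (fun t : ℝ => t ^ r * chartRep e f p) (r * chartRep e f p) 1 := by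
      simpa using (hasDerivAt_pow r (1 : ℝ)).mul_const (chartRep e f p)
    have h3 : (fun t : ℝ => chartRep e f (p.1, t • p.2)) =ᶠ[nhds 1]
        fun t : ℝ => t ^ r * chartRep e f p := by
      filter_upwards [lt_mem_nhds (zero_lt_one (α := ℝ))] with t ht
      rw [chartRep, chartVector_smul]
      exact hr _ hp.2 t ht
    have := h1.unique (h2.congr_of_eventuallyEq h3)
    rw [fderiv_apply_eq] at this
    simpa using this

theorem snd_ne_zero_of_mem_chartDomain (hA : IsConicSubbundle A) (hq : q ∈ chartDomain e A) :
    q.2 ≠ 0 := by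
  intro h
  refine hA.ne_zero _ hq.2 ?_
  exact (congrArg (chartSymmDeriv e q.1) h).trans (map_zero _)

theorem IsConicPseudoRiemannian.isLocalRiemannian (hF : IsConicPseudoRiemannian A F)
    (he : e ∈ IsManifold.maximalAtlas 𝓘(ℝ, Plane) ∞ M) :
    IsLocalRiemannian (chartDomain e A) (chartRep e F) where
  isOpen := isOpen_chartDomain he hF.conic.isOpen
  snd_ne_zero _ hq := snd_ne_zero_of_mem_chartDomain hF.conic hq
  homog := by
    simpa using chartRep_homog hF.conic he hF.smooth 1 (by simpa using hF.homogeneous)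
  det_ne_zero := hF.nondegenerate e he
  dotD_metric p hp i j k := by
    refine dotD_metric_eq_zero (isOpen_chartDomain he hF.conic.isOpen)
      (contDiffOn_chartRep he hF.smooth) (fun x => ?_) hp i j k
    obtain ⟨a, -, ha⟩ := hF.quadratic (e.symm x)
    let L : Plane →ₗ[ℝ] TangentSpace 𝓘(ℝ, Plane) (e.symm x) := (chartSymmDeriv e x).toLinearMap
    let E : Fin 2 → Plane := fun i => EuclideanSpace.single i (1 : ℝ)
    refine ⟨a (L (E 0)) (L (E 0)), a (L (E 0)) (L (E 1)) + a (L (E 1)) (L (E 0)),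
      a (L (E 1)) (L (E 1)), ?_⟩
    rintro ⟨x', y⟩ hq rfl
    have := ha (L y) hq.2
    have hy : L y = y 0 • L (E 0) + y 1 • L (E 1) := by
      rw [← map_smul, ← map_smul, ← map_add]
      exact congrArg L (plane_eq_sum y)
    change F ⟨_, L y⟩ ^ 2 = _
    rw [this, hy]
    simp only [map_add, map_smul, LinearMap.add_apply, LinearMap.smul_apply, smul_eq_mul]
    ring

theorem IsAnisotropicConformalFactor.isLocalFactor (hA : IsConicSubbundle A)
    (hφ : IsAnisotropicConformalFactor A F φ)
    (he : e ∈ IsManifold.maximalAtlas 𝓘(ℝ, Plane) ∞ M) :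
    IsLocalFactor (chartDomain e A) (chartRep e F) (chartRep e φ) where
  homog := by
    simpa using chartRep_homog hA he hφ.smooth 0 (by simpa using hφ.homogeneous)
  ne_zero := hφ.ne_zero e he

theorem isCoordChange_transition (hA : IsOpen A)
    (he : e ∈ IsManifold.maximalAtlas 𝓘(ℝ, Plane) ∞ M)
    (he' : e' ∈ IsManifold.maximalAtlas 𝓘(ℝ, Plane) ∞ M) :
    IsCoordChange (chartDomain e A ∩ Prod.fst ⁻¹' (e.target ∩ e.symm ⁻¹' e'.source))
      (chartDomain e' A) (transition e e') where
  isOpen := (isOpen_chartDomain he hA).inter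
    ((e.isOpen_inter_preimage_symm e'.open_source).preimage continuous_fst)
  isOpen' := isOpen_chartDomain he' hA
  smooth := by
    rintro _ ⟨q, hq, rfl⟩
    exact (contDiffAt_transition he he' hq.2.1 hq.2.2).contDiffWithinAt
  mapsTo q hq := by
    refine ⟨e'.map_source hq.2.2, ?_⟩
    rw [chartVector_tangentLift he he' hq.2.1 hq.2.2]
    exact hq.1.2
  surjective q hq v := by
    -- The preimage is the image of `v` under the derivative of the reverse transition.
    refine ⟨chartDeriv e (e.symm q.1) (chartSymmDeriv e' (e' (e.symm q.1)) v), ?_⟩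
    have h1 := chartSymmDeriv_chartDeriv he (e.map_target hq.2.1)
      (chartSymmDeriv e' (e' (e.symm q.1)) v)
    rw [e.right_inv hq.2.1] at h1
    rw [fderiv_transition he he' hq.2.1 hq.2.2, h1]
    have h2 := chartDeriv_chartSymmDeriv he' (e'.map_source hq.2.2) v
    rwa [e'.left_inv hq.2.2] at h2

end Manifold

/-! ### Restriction to smaller open sets -/

theorem IsHomog.mono {U V : Set (Plane × Plane)} {h : Plane × Plane → ℝ} {r : ℝ}
    (hh : IsHomog U r h) (hV : V ⊆ U) : IsHomog V r h :=
  ⟨hh.smooth.mono hV, fun p hp => hh.euler p (hV hp)⟩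

theorem IsLocalRiemannian.mono {U V : Set (Plane × Plane)} {F : Plane × Plane → ℝ}
    (hF : IsLocalRiemannian U F) (hV : V ⊆ U) (ho : IsOpen V) : IsLocalRiemannian V F where
  isOpen := ho
  snd_ne_zero p hp := hF.snd_ne_zero p (hV hp)
  homog := hF.homog.mono hV
  det_ne_zero p hp := hF.det_ne_zero p (hV hp)
  dotD_metric p hp := hF.dotD_metric p (hV hp)

theorem IsLocalFactor.mono {U V : Set (Plane × Plane)} {F φ : Plane × Plane → ℝ}
    (hφ : IsLocalFactor U F φ) (hV : V ⊆ U) : IsLocalFactor V F φ :=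
  ⟨hφ.homog.mono hV, fun p hp => hφ.ne_zero p (hV hp)⟩

/-! ### The tensor field of a change of metrics -/

section Manifold

variable {M : Type*} [TopologicalSpace M] [ChartedSpace Plane M]

variable {e : OpenPartialHomeomorph M Plane} {A : Set (TangentBundle 𝓘(ℝ, Plane) M)}
  {F φ : TangentBundle 𝓘(ℝ, Plane) M → ℝ} {q : Plane × Plane}

theorem mk_mem_chartDomain (he : e ∈ IsManifold.maximalAtlas 𝓘(ℝ, Plane) ∞ M) {x : Plane}
    (hx : x ∈ e.target) {w : Plane} (hw : w ∈ fibre A (e.symm x)) :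
    (x, chartDeriv e (e.symm x) w) ∈ chartDomain e A := by
  refine ⟨hx, ?_⟩
  have h := chartSymmDeriv_chartDeriv he (e.map_target hx) w
  rw [e.right_inv hx] at h
  have : chartVector e (x, chartDeriv e (e.symm x) w)
    = (⟨e.symm x, w⟩ : TangentBundle 𝓘(ℝ, Plane) M) := tangentBundle_ext rfl h
  rw [this]
  exact hw

theorem tensorComponent_comm {T : TensorField12 M}
    (hT : ∀ (x : M) (u v : TangentSpace 𝓘(ℝ, Plane) x), T x u v = T x v u) (i j k : Fin 2)
    (x : Plane) : tensorComponent e T i j k x = tensorComponent e T i k j x := by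
  unfold tensorComponent
  rw [hT]

/-- The vector with components `Mⁱ_jk uʲ vᵏ`. -/
def Mvec (e : OpenPartialHomeomorph M Plane) (F φ : TangentBundle 𝓘(ℝ, Plane) M → ℝ)
    (q : Plane × Plane) (u v : Plane) : Plane :=
  WithLp.toLp 2 fun i => ∑ a, ∑ b, Mexpr (chartRep e F) (chartRep e φ) i a b q * u a * v b

theorem Mvec_comm (h : ∀ i, Mexpr (chartRep e F) (chartRep e φ) i 0 1 q
    = Mexpr (chartRep e F) (chartRep e φ) i 1 0 q) (u v : Plane) :
    Mvec e F φ q u v = Mvec e F φ q v u := by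
  ext i
  simp only [Mvec, Fin.sum_univ_two]
  linear_combination (u 0 * v 1 - u 1 * v 0) * h i

variable [IsManifold 𝓘(ℝ, Plane) ∞ M]

/-- A function on a connected fibre whose fibre derivatives vanish is constant. -/
theorem eq_of_dotD_eq_zero (he : e ∈ IsManifold.maximalAtlas 𝓘(ℝ, Plane) ∞ M) (hA : IsOpen A)
    {h : Plane × Plane → ℝ} (hh : ContDiffOn ℝ ∞ h (chartDomain e A))
    (h0 : ∀ r ∈ chartDomain e A, ∀ i, dotD i h r = 0) {x y y' : Plane}
    (hc : IsPreconnected (fibre A (e.symm x))) (hy : (x, y) ∈ chartDomain e A)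
    (hy' : (x, y') ∈ chartDomain e A) : h (x, y) = h (x, y') := by
  have hx := hy.1
  have hU := isOpen_chartDomain he hA
  -- In coordinates the fibre is the image of `A_x` under the continuous linear derivative of the
  -- chart, so it inherits connectedness.
  have hS : {z : Plane | (x, z) ∈ chartDomain e A}
      = chartDeriv e (e.symm x) '' fibre A (e.symm x) := by
    ext z
    constructor
    · intro hz
      exact ⟨chartSymmDeriv e x z, hz.2, chartDeriv_chartSymmDeriv he hx z⟩
    · rintro ⟨w, hw, rfl⟩
      exact mk_mem_chartDomain he hx hw
  have hSo : IsOpen {z : Plane | (x, z) ∈ chartDomain e A} :=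
    hU.preimage (Continuous.prodMk_right x)
  have hSc : IsPreconnected {z : Plane | (x, z) ∈ chartDomain e A} := by
    rw [hS]
    exact hc.image _ (chartDeriv e (e.symm x)).continuous.continuousOn
  have hd : ∀ z ∈ {z : Plane | (x, z) ∈ chartDomain e A},
      HasFDerivAt (fun z => h (x, z)) (0 : Plane →L[ℝ] ℝ) z := by
    intro z hz
    have d := (differentiableAt_of_contDiffOn hU hh hz).hasFDerivAt
    refine (d.comp z (hasFDerivAt_prodMk_right x z)).congr_fderiv
      (ContinuousLinearMap.ext fun v => ?_)
    change fderiv ℝ h (x, z) (0, v) = 0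
    rw [fderiv_apply_eq, h0 _ hz, h0 _ hz]
    simp
  exact hSo.is_const_of_fderiv_eq_zero hSc
    (fun z hz => (hd z hz).differentiableAt.differentiableWithinAt)
    (fun z hz => (hd z hz).fderiv) hy hy'

/-- The tensor field with components `Mⁱ_jk` at a chosen vector of `A` over each point. -/
def tensorOfM (hA : IsConicSubbundle A) (F φ : TangentBundle 𝓘(ℝ, Plane) M → ℝ) :
    TensorField12 M := fun x =>
  show Plane →ₗ[ℝ] Plane →ₗ[ℝ] Plane from
  LinearMap.mk₂ ℝ (fun u v : Plane => chartSymmDeriv (chartAt Plane x) (chartAt Plane x x)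
    (Mvec (chartAt Plane x) F φ (chartAt Plane x x,
      chartDeriv (chartAt Plane x) x (hA.fibre_nonempty x).some)
      (chartDeriv (chartAt Plane x) x u) (chartDeriv (chartAt Plane x) x v)))
    (fun u u' v => by
      rw [← map_add]; congr 1; ext i; simp [Mvec]; ring)
    (fun c u v => by
      rw [← map_smul]; congr 1; ext i; simp [Mvec]; ring)
    (fun u v v' => by
      rw [← map_add]; congr 1; ext i; simp [Mvec]; ring)
    (fun c u v => by
      rw [← map_smul]; congr 1; ext i; simp [Mvec]; ring)

/-- The definition involves two choices at each point, a chart and a vector of `A`. Constancy of `M`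
on the connected fibre moves the chosen vector to the one represented by `q`, and the tensor law of
`hessian_tangentLift` moves the preferred chart to `e`. -/
theorem tensorComponent_tensorOfM (hF : IsConicPseudoRiemannian A F)
    (hφ : IsAnisotropicConformalFactor A F φ) (hM : MFibrewiseLocallyConstant A F φ)
    (hc : ∀ x : M, IsConnected (fibre A x))
    (he : e ∈ IsManifold.maximalAtlas 𝓘(ℝ, Plane) ∞ M) (hq : q ∈ chartDomain e A)
    (i j k : Fin 2) : tensorComponent e (tensorOfM hF.conic F φ) i j k q.1
      = Mexpr (chartRep e F) (chartRep e φ) i j k q := by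
  set x := e.symm q.1 with hx
  set e' := chartAt Plane x with he'_def
  have he' : e' ∈ IsManifold.maximalAtlas 𝓘(ℝ, Plane) ∞ M := IsManifold.chart_mem_maximalAtlas x
  have hxs : x ∈ e'.source := mem_chart_source Plane x
  have hψ := isCoordChange_transition hF.conic.isOpen he he'
  have hqV : q ∈ chartDomain e A ∩ Prod.fst ⁻¹' (e.target ∩ e.symm ⁻¹' e'.source) :=
    ⟨hq, hq.1, hxs⟩
  have hrep : ∀ (f : TangentBundle 𝓘(ℝ, Plane) M → ℝ),
      ∀ r ∈ chartDomain e A ∩ Prod.fst ⁻¹' (e.target ∩ e.symm ⁻¹' e'.source),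
      chartRep e f r = chartRep e' f (tangentLift (transition e e') r) := fun f r hr => by
    rw [chartRep, chartRep, chartVector_tangentLift he he' hr.2.1 hr.2.2]
  have key := hψ.hessian_tangentLift ((hF.isLocalRiemannian he).mono Set.inter_subset_left
    hψ.isOpen) (hF.isLocalRiemannian he') ((hφ.isLocalFactor hF.conic he).mono
    Set.inter_subset_left) (hφ.isLocalFactor hF.conic he') (hrep F) (hrep φ) hqV
  set w : Plane := (hF.conic.fibre_nonempty x).some with hw
  have hws : w ∈ fibre A x := (hF.conic.fibre_nonempty x).some_mem
  have hl : e'.symm (e' x) = x := e'.left_inv hxs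
  have hconst : ∀ a b c, Mexpr (chartRep e' F) (chartRep e' φ) a b c (e' x, chartDeriv e' x w)
      = Mexpr (chartRep e' F) (chartRep e' φ) a b c (tangentLift (transition e e') q) := by
    intro a b c
    have h2 : (e' x, chartDeriv e' x w) ∈ chartDomain e' A := by
      have := mk_mem_chartDomain (A := A) (w := w) he' (e'.map_source hxs) (by rw [hl]; exact hws)
      rwa [hl] at this
    exact eq_of_dotD_eq_zero he' hF.conic.isOpen
      ((hφ.isLocalFactor hF.conic he').contDiffOn_Mexpr (hF.isLocalRiemannian he') a b c)
      (fun r hr l => hM e' he' r hr a b c l) (hc _).isPreconnected h2 (hψ.mapsTo q hqV)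
  let E : Fin 2 → Plane := fun i => EuclideanSpace.single i (1 : ℝ)
  let V : Plane := WithLp.toLp 2 fun l => Mexpr (chartRep e F) (chartRep e φ) l j k q
  have hV : Mvec e' F φ (e' x, chartDeriv e' x w) (chartDeriv e' x (chartSymmDeriv e q.1 (E j)))
      (chartDeriv e' x (chartSymmDeriv e q.1 (E k)))
      = chartDeriv e' x (chartSymmDeriv e q.1 V) := by
    rw [← fderiv_transition he he' hq.1 hxs, ← fderiv_transition he he' hq.1 hxs,
      ← fderiv_transition he he' hq.1 hxs]
    ext l
    rw [fderiv_apply_apply]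
    simp only [Mvec, hconst]
    have := key l j k
    rw [Fin.sum_univ_two (f := fun l' => jacobian (transition e e') l l' q * _)] at this
    exact this
  change chartDeriv e x (chartSymmDeriv e' (e' x) (Mvec e' F φ (e' x, chartDeriv e' x w)
    (chartDeriv e' x (chartSymmDeriv e q.1 (E j)))
    (chartDeriv e' x (chartSymmDeriv e q.1 (E k))))) i = _
  rw [hV, chartSymmDeriv_chartDeriv he' hxs, hx, chartDeriv_chartSymmDeriv he hq.1]

/-- The domain is open, so near a given `x` the coordinate vector `y` can be held fixed. There the
component is `z ↦ M(z, y)`, which is smooth; no smooth section of `A` has to be chosen. -/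
theorem contDiffOn_tensorComponent (hF : IsConicPseudoRiemannian A F)
    (hφ : IsAnisotropicConformalFactor A F φ) {T : TensorField12 M} (hT : IsGivenByM A F φ T)
    (he : e ∈ IsManifold.maximalAtlas 𝓘(ℝ, Plane) ∞ M) (i j k : Fin 2) :
    ContDiffOn ℝ ∞ (tensorComponent e T i j k) e.target := by
  intro x hx
  obtain ⟨w, hw⟩ := hF.conic.fibre_nonempty (e.symm x)
  have hq := mk_mem_chartDomain he hx hw
  set y := chartDeriv e (e.symm x) w
  have hU := isOpen_chartDomain he hF.conic.isOpen
  have hs := ((hφ.isLocalFactor hF.conic he).contDiffOn_Mexpr (hF.isLocalRiemannian he)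
    i j k).contDiffAt (hU.mem_nhds hq)
  have hc : ContDiffAt ℝ ∞ (fun z : Plane => (z, y)) x := contDiffAt_id.prodMk contDiffAt_const
  have h2 : ContDiffAt ℝ ∞ (fun z => Mexpr (chartRep e F) (chartRep e φ) i j k (z, y)) x :=
    (ContDiffAt.comp x hs hc :)
  refine (h2.congr_of_eventuallyEq ?_).contDiffWithinAt
  filter_upwards [hc.continuousAt.preimage_mem_nhds (hU.mem_nhds hq)] with z hz
  exact hT e he (z, y) hz i j k

theorem exists_isGivenByM (hF : IsConicPseudoRiemannian A F)
    (hφ : IsAnisotropicConformalFactor A F φ) (hM : MFibrewiseLocallyConstant A F φ)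
    (hc : ∀ x : M, IsConnected (fibre A x)) :
    ∃ T : TensorField12 M, IsSmoothSymmetric T ∧ IsGivenByM A F φ T := by
  have hT : IsGivenByM A F φ (tensorOfM hF.conic F φ) := fun e he q hq i j k =>
    tensorComponent_tensorOfM hF hφ hM hc he hq i j k
  refine ⟨tensorOfM hF.conic F φ, ⟨fun x u v => ?_, fun e he i j k =>
    contDiffOn_tensorComponent hF hφ hT he i j k⟩, hT⟩
  have he : chartAt Plane x ∈ IsManifold.maximalAtlas 𝓘(ℝ, Plane) ∞ M :=
    IsManifold.chart_mem_maximalAtlas x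
  have hxs := mem_chart_source Plane x
  have hl := (chartAt Plane x).left_inv hxs
  have hw := (hF.conic.fibre_nonempty x).some_mem
  have hq := mk_mem_chartDomain (A := A) (w := (hF.conic.fibre_nonempty x).some) he
    ((chartAt Plane x).map_source hxs) (by rw [hl]; exact hw)
  rw [hl] at hq
  exact congrArg (chartSymmDeriv (chartAt Plane x) (chartAt Plane x x)) (Mvec_comm
    (fun i => (hφ.isLocalFactor hF.conic he).Mexpr_comm (hF.isLocalRiemannian he) hq i 0 1) _ _)

theorem pqIdentities_iff (hF : IsConicPseudoRiemannian A F)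
    (hφ : IsAnisotropicConformalFactor A F φ) :
    PQIdentities A F φ ↔ MFibrewiseLocallyConstant A F φ := by
  refine forall_congr' fun e => forall_congr' fun he => forall_congr' fun q =>
    forall_congr' fun hq => ?_
  have hR := hF.isLocalRiemannian he
  have hL := hφ.isLocalFactor hF.conic he
  simp only [hL.dotD_Mexpr hR hq]
  exact hL.identities_iff hR hq

theorem isBerwald_conformalChange_iff (hF : IsConicPseudoRiemannian A F)
    (hφ : IsAnisotropicConformalFactor A F φ) :
    IsBerwald A (conformalChange φ F) ↔ MFibrewiseLocallyConstant A F φ := by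
  refine forall_congr' fun e => forall_congr' fun he => forall_congr' fun q =>
    forall_congr' fun hq => ?_
  have hR := hF.isLocalRiemannian he
  have hL := hφ.isLocalFactor hF.conic he
  simp only [hL.dotD_Mexpr hR hq]
  have h : ∀ a b c d, berwaldCurvature (chartRep e (conformalChange φ F)) a b c d q = _ :=
    fun a b c d => hL.berwaldCurvature_expMul hR hq a b c d
  simp only [h]
  exact ⟨fun h i j k r => h i k j r, fun h i j k r => h i k j r⟩

theorem MFibrewiseLocallyConstant.of_isGivenByM (hF : IsConicPseudoRiemannian A F)
    (hφ : IsAnisotropicConformalFactor A F φ) {T : TensorField12 M} (hT : IsGivenByM A F φ T) :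
    MFibrewiseLocallyConstant A F φ := by
  intro e he q hq i j k r
  have hU := isOpen_chartDomain he hF.conic.isOpen
  refine dotD_eq_zero_of_forall_fst_eq hU (differentiableAt_of_contDiffOn hU
    ((hφ.isLocalFactor hF.conic he).contDiffOn_Mexpr (hF.isLocalRiemannian he) i j k) hq) hq
    (fun z hz hzq => ?_) r
  rw [← hT e he z hz, ← hT e he q hq, hzq]

theorem isGivenByM_iff_satisfiesFuster (hF : IsConicPseudoRiemannian A F)
    (hφ : IsAnisotropicConformalFactor A F φ) {T : TensorField12 M} (hT : IsSmoothSymmetric T) :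
    IsGivenByM A F φ T ↔ SatisfiesFuster A F φ T := by
  refine forall_congr' fun e => forall_congr' fun he => ?_
  have hU := isOpen_chartDomain he hF.conic.isOpen
  have hs : ∀ i j k, ContDiffOn ℝ ∞ (fun q : Plane × Plane => tensorComponent e T i j k q.1)
      (chartDomain e A) := fun i j k =>
    (hT.smooth e he i j k).comp contDiff_fst.contDiffOn fun q hq => hq.1
  have h0 : ∀ i j k r, ∀ q ∈ chartDomain e A,
      dotD r (fun q : Plane × Plane => tensorComponent e T i j k q.1) q = 0 :=
    fun i j k r q hq => dotD_eq_zero_of_forall_fst_eq hU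
      (differentiableAt_of_contDiffOn hU (hs i j k) hq) hq (fun z _ hz => by rw [hz]) r
  exact (hφ.isLocalFactor hF.conic he).eq_Mexpr_iff (hF.isLocalRiemannian he)
    (T := fun i j k q => tensorComponent e T i j k q.1)
    (fun i j k => .of_dotD_eq_zero (hs i j k) fun q hq r => h0 i j k r q hq) h0
    (fun i j k q _ => tensorComponent_comm hT.symm i j k q.1)

end Manifold

end ConicFinsler

end

/-! ### The main theorem -/

theorem mainTheorem2 {M : Type*} [TopologicalSpace M] [ChartedSpace ConicFinsler.Plane M]
    [IsManifold 𝓘(ℝ, ConicFinsler.Plane) ∞ M]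
    (A : Set (TangentBundle 𝓘(ℝ, ConicFinsler.Plane) M))
    (F φ : TangentBundle 𝓘(ℝ, ConicFinsler.Plane) M → ℝ)
    (hF : ConicFinsler.IsConicPseudoRiemannian A F)
    (hφ : ConicFinsler.IsAnisotropicConformalFactor A F φ) :
    List.TFAE [
      ConicFinsler.PQIdentities A F φ,
      ConicFinsler.MFibrewiseLocallyConstant A F φ,
      ConicFinsler.IsBerwald A (ConicFinsler.conformalChange φ F)] ∧
    ((∃ T : ConicFinsler.TensorField12 M,
        ConicFinsler.IsSmoothSymmetric T ∧ ConicFinsler.IsGivenByM A F φ T) →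
      ConicFinsler.PQIdentities A F φ) ∧
    ((∀ x : M, IsConnected (ConicFinsler.fibre A x)) →
      List.TFAE [
        ConicFinsler.PQIdentities A F φ,
        ∃ T : ConicFinsler.TensorField12 M,
          ConicFinsler.IsSmoothSymmetric T ∧ ConicFinsler.IsGivenByM A F φ T,
        ConicFinsler.IsBerwald A (ConicFinsler.conformalChange φ F)]) ∧
    (∀ T : ConicFinsler.TensorField12 M, ConicFinsler.IsSmoothSymmetric T →
      (ConicFinsler.IsGivenByM A F φ T ↔ ConicFinsler.SatisfiesFuster A F φ T)) := by
  have h12 := ConicFinsler.pqIdentities_iff hF hφ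
  have h32 := ConicFinsler.isBerwald_conformalChange_iff hF hφ
  have h41 : (∃ T : ConicFinsler.TensorField12 M,
      ConicFinsler.IsSmoothSymmetric T ∧ ConicFinsler.IsGivenByM A F φ T) →
      ConicFinsler.PQIdentities A F φ := fun ⟨_, _, hT⟩ =>
    h12.2 (.of_isGivenByM hF hφ hT)
  refine ⟨?_, h41, fun hc => ?_, fun T hT =>
    ConicFinsler.isGivenByM_iff_satisfiesFuster hF hφ hT⟩
  · tfae_have 1 ↔ 2 := h12
    tfae_have 3 ↔ 2 := h32
    tfae_finish
  · tfae_have 2 → 1 := h41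
    tfae_have 1 → 2 := fun h => ConicFinsler.exists_isGivenByM hF hφ (h12.1 h) hc
    tfae_have 1 ↔ 3 := h12.trans h32.symm
    tfae_finish
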